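/- Let $\{X_{i,k};\, i\ge 1,\ k\ge 1\}$ be i.i.d. real random variables on one probability space, with mean $\mu$ and variance $\operatorname{Var}(X_{1,1})>0$. Let $\{p_n\}_{n\ge 1}$ be positive integers and let $$M_n=\max_{1\le i<j\le p_n}\Big(\sum_{k=1}^n |X_{i,k}-X_{j,k}|^2\Big)^{1/2}$$ be the maximum interpoint distance of the rows of the $p_n\times n$ matrix $(X_{i,k})_{1\le i\le p_n,\,1\le k\le n}$. Assume (i) $E\,e^{t_0|X_{1,1}|^{2\alpha}}<\infty$ for some $0<\alpha\le 1/2$ and some $t_0>0$; (ii) $\log p_n=o\big(n^{\alpha/(2-\alpha)}\big)$ and $\log\log n=o(\log p_n)$ as $n\to\infty$ (the second condition says that $p_n$ grows faster than every fixed power of $\log n$; in particular $p_n\to\infty$); (iii) $\operatorname{Corr}\big(|X_{1,1}-X_{2,1}|^2,\,|X_{1,1}-X_{3,1}|^2\big)<1/3$. Then, as $n\to\infty$, $$\frac{M_n^2-2n\,E|X_{1,1}-\mu|^2}{\sqrt{2\big(E|X_{1,1}-\mu|^4+(E|X_{1,1}-\mu|^2)^2\big)\,n\log p_n}}\ \longrightarrow\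 2\qquad\text{almost surely.}$$ -/

import Mathlib

open MeasureTheory ProbabilityTheory Filter Topology Asymptotics

noncomputable section

/-- The (Pearson) correlation coefficient of two real random variables. -/
def corr {Ω : Type*} [MeasurableSpace Ω] (P : Measure Ω) (Y Z : Ω → ℝ) : ℝ :=
  cov[Y, Z; P] / Real.sqrt (Var[Y; P] * Var[Z; P])

/-- The `i`-th row, truncated to its first `n` entries, of the array `X`, as a random point of
Euclidean `n`-space. Rows and columns are numbered from `0`. -/
def rowVec {Ω : Type*} (X : ℕ → ℕ → Ω → ℝ) (n i : ℕ) (ω : Ω) : EuclideanSpace ℝ (Fin n) :=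
  WithLp.toLp 2 fun k : Fin n => X i k ω

/-- The maximum interpoint distance `max_{i < j} ‖X_i - X_j‖₂` of the first `p` rows of `X`,
each truncated to its first `n` entries. -/
def maxInterpointDist {Ω : Type*} (X : ℕ → ℕ → Ω → ℝ) (p n : ℕ) (ω : Ω) : ℝ :=
  ⨆ q : {q : Fin p × Fin p // q.1 < q.2}, ‖rowVec X n q.1.1 ω - rowVec X n q.1.2 ω‖

end

/-! With `c = 2 c₂`, the squared distance of rows `i` and `j` minus `n c` is a sum `S_ij(n)` of
i.i.d. centered variables of variance `v = 2 (c₄ + c₂²)`, where `c₂` and `c₄` are central moments of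
the entries. Hence `M_n² - n c` is the maximum of about `p²/2` such sums. At level `x √(v n log p)`
each sum has tail `p^(-x²/2 + o(1))`, which balances the number of pairs exactly at `x = 2`.

The upper half is a union bound. The stretched exponential moment gives the Gaussian exponent up to
`√(n log p)`, after truncation (`exists_max_sum_tail_le`); the growth bound on `log p` is what makes
this level admissible.

The lower half is a second moment argument (`measureReal_forall_notMem_grid_le`) for which the CLT
on independent blocks supplies the lower tail (`exists_le_sum_tail`). Only pairs of sums sharing a
row are dependent. Two of them are both large only if their sum, of variance at most `w` per step,
exceeds twice the level, which has probability about `p^(-8v/w)` near `x = 2`. This must beat the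
`p³` such configurations, so `w < 8v/3`, and that is the condition that the correlation be below
`1/3`.

For almost sure convergence, `n` is compared with a geometric scale `⌈θ^m⌉` and `p_n` with a dyadic
scale `2^(l+1)`. Maximal inequalities control all times within a scale. As `p_n` need not be
monotone, Borel–Cantelli runs over all pairs `(m, l)`; the failure probability is a negative power
of `2^(l+1)`, and `log log n = o(log p_n)` makes `m` smaller than any fixed power of it, so the
double sum converges. -/

/-! ### Maximal inequalities for products and sums of independent variables. -/

/-- The partial products of `Z`, frozen once they reach the level `c`. -/
noncomputable def stoppedProd {Ω : Type*} (Z : ℕ → Ω → ENNReal) (c : ENNReal) : ℕ → Ω → ENNReal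
  | 0, _ => 1
  | k + 1, ω => if c ≤ stoppedProd Z c k ω then stoppedProd Z c k ω
      else stoppedProd Z c k ω * Z k ω

/-- Dependence on the past factors only is what makes the stopped product independent of the next
factor. -/
theorem stoppedProd_measurable {Ω : Type*} (Z : ℕ → Ω → ENNReal) (c : ENNReal) (n : ℕ) :
    Measurable[⨆ j ∈ Set.Iio n, MeasurableSpace.comap (Z j) inferInstance]
      (stoppedProd Z c n) := by
  induction n with
  | zero => exact @measurable_const _ _ _ (_) _
  | succ k ih =>
    have hle : (⨆ j ∈ Set.Iio k, MeasurableSpace.comap (Z j) inferInstance)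
        ≤ ⨆ j ∈ Set.Iio (k + 1), MeasurableSpace.comap (Z j) inferInstance :=
      biSup_mono fun j (hj : j < k) => Nat.lt_succ_of_lt hj
    have ih' := ih.mono hle le_rfl
    have hZ : Measurable[⨆ j ∈ Set.Iio (k + 1), MeasurableSpace.comap (Z j) inferInstance]
        (Z k) := by
      refine (comap_measurable (Z k)).mono ?_ le_rfl
      exact le_biSup (fun j => MeasurableSpace.comap (Z j) inferInstance)
        (Set.mem_Iio.2 (Nat.lt_succ_self k))
    exact @Measurable.ite _ _ (_) _ _ _ _ _
      (ih' measurableSet_Ici) ih'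
      (@Measurable.mul _ _ _ _ _ (_) _ _ ih' hZ)

/-- Whether the next factor is multiplied in is decided by the past, so by independence a step
multiplies the unfrozen part of the integral by at most `ρ`. The frozen part is unchanged, which `1
≤ ρ` absorbs. -/
theorem stoppedProd_lintegral_le {Ω : Type*} [MeasurableSpace Ω] {P : Measure Ω}
    [IsProbabilityMeasure P] {Z : ℕ → Ω → ENNReal} (hm : ∀ k, Measurable (Z k))
    (hi : iIndepFun Z P) {ρ : ENNReal} (hρ : 1 ≤ ρ) (hZ : ∀ k, ∫⁻ ω, Z k ω ∂P ≤ ρ)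
    (c : ENNReal) (n : ℕ) : ∫⁻ ω, stoppedProd Z c n ω ∂P ≤ ρ ^ n := by
  induction n with
  | zero => simp [stoppedProd]
  | succ k ih =>
    have hle : (⨆ j ∈ Set.Iio k, MeasurableSpace.comap (Z j) inferInstance)
        ≤ (inferInstance : MeasurableSpace Ω) :=
      iSup₂_le fun j _ => (hm j).comap_le
    have hW := stoppedProd_measurable Z c k
    have hWm : Measurable (stoppedProd Z c k) := hW.mono hle le_rfl
    have hind : Indep (⨆ j ∈ Set.Iio k, MeasurableSpace.comap (Z j) inferInstance)
        (MeasurableSpace.comap (Z k) inferInstance) P := by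
      have := indep_iSup_of_disjoint (μ := P) (fun j => (hm j).comap_le) hi.iIndep
        (S := Set.Iio k) (T := {k}) (by simp)
      simpa using this
    set A : Set Ω := {ω | c ≤ stoppedProd Z c k ω}
    have hA : MeasurableSet[⨆ j ∈ Set.Iio k, MeasurableSpace.comap (Z j) inferInstance] A :=
      hW measurableSet_Ici
    have hA' : MeasurableSet A := hle _ hA
    have hprod : ∫⁻ ω, Aᶜ.indicator (stoppedProd Z c k) ω * Z k ω ∂P
        = (∫⁻ ω, Aᶜ.indicator (stoppedProd Z c k) ω ∂P) * ∫⁻ ω, Z k ω ∂P :=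
      lintegral_mul_eq_lintegral_mul_lintegral_of_independent_measurableSpace hle
        (hm k).comap_le hind
        (@Measurable.indicator _ _ (_) _ _ _ _ hW (@MeasurableSet.compl _ _ (_) hA))
        (comap_measurable _)
    have hsplit : ∀ ω, stoppedProd Z c (k + 1) ω
        = A.indicator (stoppedProd Z c k) ω + Aᶜ.indicator (stoppedProd Z c k) ω * Z k ω := by
      intro ω
      by_cases h : ω ∈ A
      · simp [h, stoppedProd, show c ≤ stoppedProd Z c k ω from h]
      · simp [h, stoppedProd, show ¬ c ≤ stoppedProd Z c k ω from h]
    calc ∫⁻ ω, stoppedProd Z c (k + 1) ω ∂P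
        = ∫⁻ ω, A.indicator (stoppedProd Z c k) ω ∂P
          + (∫⁻ ω, Aᶜ.indicator (stoppedProd Z c k) ω ∂P) * ∫⁻ ω, Z k ω ∂P := by
          rw [lintegral_congr hsplit, lintegral_add_left (hWm.indicator hA'), hprod]
      _ ≤ (∫⁻ ω, A.indicator (stoppedProd Z c k) ω ∂P) * ρ
          + (∫⁻ ω, Aᶜ.indicator (stoppedProd Z c k) ω ∂P) * ρ := by
          gcongr
          · exact le_mul_of_one_le_right' hρ
          · exact hZ k
      _ = (∫⁻ ω, stoppedProd Z c k ω ∂P) * ρ := by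
          rw [← add_mul, ← lintegral_add_left (hWm.indicator hA')]
          congr 1
          refine lintegral_congr fun ω => ?_
          exact Set.indicator_self_add_compl_apply A _ ω
      _ ≤ ρ ^ k * ρ := by gcongr
      _ = ρ ^ (k + 1) := (pow_succ _ _).symm

/-- Before freezing, the stopped and the plain product agree; once the level is reached, the stopped
product never leaves it. -/
theorem le_stoppedProd_of_le_prod {Ω : Type*} {Z : ℕ → Ω → ENNReal} {c : ENNReal} {ω : Ω} (N : ℕ)
    {n : ℕ} (hn : n ≤ N) (h : c ≤ ∏ k ∈ Finset.range n, Z k ω) : c ≤ stoppedProd Z c N ω := by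
  have key : ∀ N, c ≤ stoppedProd Z c N ω ∨ stoppedProd Z c N ω = ∏ k ∈ Finset.range N, Z k ω := by
    intro N
    induction N with
    | zero => right; simp [stoppedProd]
    | succ k ih =>
      by_cases hc : c ≤ stoppedProd Z c k ω
      · left; simp [stoppedProd, hc]
      · right
        rw [Finset.prod_range_succ, ← ih.resolve_left hc]
        simp [stoppedProd, hc]
  induction N, hn using Nat.le_induction with
  | base =>
    rcases key n with h' | h'
    · exact h'
    · rw [h']; exact h
  | succ k _ ih => simp [stoppedProd, ih]

/-- Doob's maximal inequality for products of independent nonnegative variables. -/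
theorem measure_exists_le_prod_le {Ω : Type*} [MeasurableSpace Ω] {P : Measure Ω}
    [IsProbabilityMeasure P] {Z : ℕ → Ω → ENNReal} (hm : ∀ k, Measurable (Z k))
    (hi : iIndepFun Z P) {ρ : ENNReal} (hρ : 1 ≤ ρ) (hZ : ∀ k, ∫⁻ ω, Z k ω ∂P ≤ ρ)
    (c : ENNReal) (N : ℕ) :
    c * P {ω | ∃ n ≤ N, c ≤ ∏ k ∈ Finset.range n, Z k ω} ≤ ρ ^ N := by
  have hle : (⨆ j ∈ Set.Iio N, MeasurableSpace.comap (Z j) inferInstance)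
        ≤ (inferInstance : MeasurableSpace Ω) :=
      iSup₂_le fun j _ => (hm j).comap_le
  calc c * P {ω | ∃ n ≤ N, c ≤ ∏ k ∈ Finset.range n, Z k ω}
      ≤ c * P {ω | c ≤ stoppedProd Z c N ω} := by
        gcongr
        rintro ⟨n, hn, h⟩
        exact le_stoppedProd_of_le_prod N hn h
    _ ≤ ∫⁻ ω, stoppedProd Z c N ω ∂P :=
        mul_meas_ge_le_lintegral ((stoppedProd_measurable Z c N).mono hle le_rfl) c
    _ ≤ ρ ^ N := stoppedProd_lintegral_le hm hi hρ hZ c N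

/-- An exponential maximal inequality for partial sums of independent variables. -/
theorem measureReal_exists_le_sum_le {Ω : Type*} [MeasurableSpace Ω] {P : Measure Ω}
    [IsProbabilityMeasure P] {Y : ℕ → Ω → ℝ} (hm : ∀ k, Measurable (Y k))
    (hi : iIndepFun Y P) {l b : ℝ} (hl : 0 < l) (hb : 0 ≤ b)
    (hint : ∀ k, Integrable (fun ω => Real.exp (l * Y k ω)) P)
    (hY : ∀ k, ∫ ω, Real.exp (l * Y k ω) ∂P ≤ Real.exp b) (x : ℝ) (N : ℕ) :
    P.real {ω | ∃ n ≤ N, x ≤ ∑ k ∈ Finset.range n, Y k ω} ≤ Real.exp (N * b - l * x) := by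
  have hme : ∀ _ : ℕ, Measurable fun y : ℝ => ENNReal.ofReal (Real.exp (l * y)) := fun _ => by
    fun_prop
  have h := measure_exists_le_prod_le (P := P) (Z := fun k ω => ENNReal.ofReal (Real.exp (l * Y k ω)))
    (fun k => (hme k).comp (hm k)) (hi.comp _ hme) (ρ := ENNReal.ofReal (Real.exp b))
    (by simpa using hb)
    (fun k => by
      rw [← ofReal_integral_eq_lintegral_ofReal (hint k)
        (Eventually.of_forall fun _ => (Real.exp_pos _).le)]
      exact ENNReal.ofReal_le_ofReal (hY k))
    (ENNReal.ofReal (Real.exp (l * x))) N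
  have hset : {ω | ∃ n ≤ N, ENNReal.ofReal (Real.exp (l * x))
      ≤ ∏ k ∈ Finset.range n, ENNReal.ofReal (Real.exp (l * Y k ω))}
      = {ω | ∃ n ≤ N, x ≤ ∑ k ∈ Finset.range n, Y k ω} := by
    ext ω
    simp only [Set.mem_ofPred_eq]
    refine exists_congr fun n => and_congr_right fun _ => ?_
    rw [← ENNReal.ofReal_prod_of_nonneg (fun _ _ => (Real.exp_pos _).le), ← Real.exp_sum,
      ENNReal.ofReal_le_ofReal_iff (Real.exp_pos _).le, Real.exp_le_exp, ← Finset.mul_sum,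
      mul_le_mul_iff_right₀ hl]
  rw [hset, ← ENNReal.ofReal_pow (Real.exp_pos _).le, ← Real.exp_nat_mul] at h
  have h2 := ENNReal.toReal_mono ENNReal.ofReal_ne_top h
  rw [ENNReal.toReal_mul, ENNReal.toReal_ofReal (Real.exp_pos _).le,
    ENNReal.toReal_ofReal (Real.exp_pos _).le] at h2
  rw [Real.exp_sub, le_div_iff₀ (Real.exp_pos _), mul_comm]
  exact h2

/-! ### I.i.d. sequences with a prescribed law. -/

/-- A sequence of independent random variables with common law `ν`. -/
structure IIDSeq {Ω : Type*} [MeasurableSpace Ω] (Y : ℕ → Ω → ℝ) (ν : Measure ℝ)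
    (P : Measure Ω) : Prop where
  measurable : ∀ k, Measurable (Y k)
  indep : iIndepFun Y P
  law : ∀ k, P.map (Y k) = ν

namespace IIDSeq

variable {Ω : Type*} [MeasurableSpace Ω] {Y : ℕ → Ω → ℝ} {ν : Measure ℝ} {P : Measure Ω}

theorem shift (h : IIDSeq Y ν P) (s : ℕ) : IIDSeq (fun k => Y (s + k)) ν P where
  measurable _ := h.measurable _
  indep := h.indep.precomp (add_right_injective s)
  law _ := h.law _

theorem neg (h : IIDSeq Y ν P) : IIDSeq (fun k ω => -Y k ω) (ν.map fun y => -y) P where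
  measurable k := (h.measurable k).neg
  indep := h.indep.comp (fun _ y => -y) fun _ => measurable_neg
  law k := by
    rw [← h.law k, Measure.map_map measurable_neg (h.measurable k)]
    rfl

theorem integral_comp (h : IIDSeq Y ν P) {f : ℝ → ℝ} (hf : Measurable f) (k : ℕ) :
    ∫ ω, f (Y k ω) ∂P = ∫ y, f y ∂ν := by
  rw [← h.law k, integral_map (h.measurable k).aemeasurable hf.aestronglyMeasurable]

theorem integrable_comp (h : IIDSeq Y ν P) {f : ℝ → ℝ}
    (hi : Integrable f ν) (k : ℕ) : Integrable (fun ω => f (Y k ω)) P := by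
  rw [← h.law k] at hi
  exact hi.comp_measurable (h.measurable k)

theorem measureReal_preimage (h : IIDSeq Y ν P) {s : Set ℝ} (hs : MeasurableSet s) (k : ℕ) :
    P.real {ω | Y k ω ∈ s} = ν.real s := by
  rw [← h.law k, measureReal_def, measureReal_def, Measure.map_apply (h.measurable k) hs]
  rfl

end IIDSeq

/-! ### Moderate deviations, upper bound. -/

/-- For `u ≥ 0` this is Taylor's remainder. For `u ≤ 0` the quadratic alone suffices, because `(1 +
u + u²/2)(1 - u + u²/2) = 1 + u⁴/4 ≥ 1`. Negative values thus carry no exponential weight, so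
truncation is needed only from above. -/
theorem exp_le_quadratic_add_cubic (u : ℝ) :
    Real.exp u ≤ 1 + u + u ^ 2 / 2 + |u| ^ 3 * Real.exp (max u 0) := by
  rcases le_total 0 u with h | h
  · have h1 := Complex.norm_exp_sub_sum_le_norm_mul_exp (u : ℂ) 3
    rw [show Complex.exp u - ∑ m ∈ Finset.range 3, (u : ℂ) ^ m / m.factorial
      = ((Real.exp u - (1 + u + u ^ 2 / 2) : ℝ) : ℂ) by
        simp [Finset.sum_range_succ, Nat.factorial], Complex.norm_real, Complex.norm_real,
      Real.norm_eq_abs, Real.norm_eq_abs] at h1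
    have h2 := (le_abs_self _).trans h1
    rw [abs_of_nonneg h] at h2 ⊢
    rw [max_eq_left h]
    linarith
  · have h1 := Real.quadratic_le_exp_of_nonneg (neg_nonneg.2 h)
    have h2 : Real.exp u * Real.exp (-u) = 1 := by rw [← Real.exp_add]; simp
    have h3 : 0 ≤ |u| ^ 3 * Real.exp (max u 0) := by positivity
    have h4 : Real.exp u ≤ 1 + u + u ^ 2 / 2 := by
      have h5 : 0 < 1 + u + u ^ 2 / 2 := by nlinarith [sq_nonneg (1 + u)]
      by_contra! hc
      have h6 : (1 + u + u ^ 2 / 2) * (1 + -u + (-u) ^ 2 / 2) < Real.exp u * Real.exp (-u) :=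
        mul_lt_mul hc h1 (by nlinarith [sq_nonneg (1 - u)]) (Real.exp_pos _).le
      rw [h2] at h6
      nlinarith [sq_nonneg (u ^ 2)]
    linarith

theorem exists_pow_le_mul_exp_rpow {α c : ℝ} (hα : 0 < α) (hc : 0 < c) (k : ℕ) :
    ∃ K : ℝ, 0 < K ∧ ∀ s : ℝ, 0 ≤ s → s ^ k ≤ K * Real.exp (c * s ^ α) := by
  obtain ⟨m, hm⟩ := exists_nat_ge (k / α)
  refine ⟨1 + m.factorial / c ^ m, by positivity, fun s hs => ?_⟩
  have he : 1 ≤ Real.exp (c * s ^ α) := Real.one_le_exp (by positivity)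
  have hf : 0 ≤ m.factorial / c ^ m := by positivity
  rcases le_total s 1 with h | h
  · calc s ^ k ≤ 1 := pow_le_one₀ hs h
      _ ≤ (1 + m.factorial / c ^ m) * 1 := by linarith
      _ ≤ _ := by gcongr
  · have h1 : s ^ k ≤ (s ^ α) ^ m := by
      rw [← Real.rpow_natCast, ← Real.rpow_natCast, ← Real.rpow_mul hs]
      refine Real.rpow_le_rpow_of_exponent_le h ?_
      rw [div_le_iff₀ hα] at hm
      linarith
    have h2 := Real.pow_div_factorial_le_exp (c * s ^ α) (by positivity) m
    calc s ^ k ≤ (s ^ α) ^ m := h1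
      _ = (m.factorial / c ^ m) * ((c * s ^ α) ^ m / m.factorial) := by
          rw [mul_pow]; field_simp
      _ ≤ (m.factorial / c ^ m) * Real.exp (c * s ^ α) := by gcongr
      _ ≤ _ := by gcongr; linarith

section StretchedExponential

variable {ν : Measure ℝ} {α t : ℝ}

theorem integrable_pow_mul_exp_rpow (hα : 0 < α) (ht : 0 < t)
    (hexp : Integrable (fun y => Real.exp (t * |y| ^ α)) ν) (k : ℕ) :
    Integrable (fun y => |y| ^ k * Real.exp (t / 2 * |y| ^ α)) ν := by
  obtain ⟨K, hK, h⟩ := exists_pow_le_mul_exp_rpow hα (half_pos ht) k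
  refine (hexp.const_mul K).mono' (by fun_prop) (Eventually.of_forall fun y => ?_)
  rw [Real.norm_of_nonneg (by positivity)]
  calc |y| ^ k * Real.exp (t / 2 * |y| ^ α)
      ≤ K * Real.exp (t / 2 * |y| ^ α) * Real.exp (t / 2 * |y| ^ α) := by
        gcongr; exact h _ (abs_nonneg y)
    _ = K * Real.exp (t * |y| ^ α) := by
        rw [mul_assoc, ← Real.exp_add]; ring_nf

theorem integrable_pow_of_exp_rpow (hα : 0 < α) (ht : 0 < t)
    (hexp : Integrable (fun y => Real.exp (t * |y| ^ α)) ν) (k : ℕ) :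
    Integrable (fun y => y ^ k) ν := by
  refine (integrable_pow_mul_exp_rpow hα ht hexp k).mono' (by fun_prop)
    (Eventually.of_forall fun y => ?_)
  rw [norm_pow, Real.norm_eq_abs]
  exact le_mul_of_one_le_right (by positivity) (Real.one_le_exp (by positivity))

variable [IsProbabilityMeasure ν]

/-- For `z = min y x > 0`, `l z = l z^(1-α) z^α ≤ l x^(1-α) |y|^α`, so `hlx` puts the exponential of
the truncated variable under half of the available stretched exponential weight; the other half pays
for `|y|³`. The linear term keeps `y` itself since `min y x ≤ y`. -/
theorem exp_mul_min_le (hα : 0 < α) (hα1 : α < 1) {l x : ℝ} (hl : 0 < l) (hx : 0 < x)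
    (hlx : l * x ^ (1 - α) ≤ t / 2) (ht : 0 < t) (y : ℝ) :
    Real.exp (l * min y x) ≤
      1 + l * y + l ^ 2 / 2 * y ^ 2 + l ^ 3 * (|y| ^ 3 * Real.exp (t / 2 * |y| ^ α)) := by
  have habs : |min y x| ≤ |y| := by
    rcases le_total y x with h | h
    · rw [min_eq_left h]
    · rw [min_eq_right h, abs_of_pos hx]; exact h.trans (le_abs_self y)
  have hmax : max (l * min y x) 0 ≤ t / 2 * |y| ^ α := by
    refine max_le ?_ (by positivity)
    rcases le_or_gt (min y x) 0 with h | h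
    · exact (mul_nonpos_of_nonneg_of_nonpos hl.le h).trans (by positivity)
    · set z := min y x
      have hz : z = z ^ (1 - α) * z ^ α := by
        rw [← Real.rpow_add h]; simp
      calc l * z = l * z ^ (1 - α) * z ^ α := by rw [mul_assoc, ← hz]
        _ ≤ l * x ^ (1 - α) * |y| ^ α := by
          refine mul_le_mul (mul_le_mul_of_nonneg_left (Real.rpow_le_rpow h.le (min_le_right _ _)
            (by linarith)) hl.le) (Real.rpow_le_rpow h.le
            ((min_le_left _ _).trans (le_abs_self y)) hα.le) (by positivity) (by positivity)
        _ ≤ t / 2 * |y| ^ α := by gcongr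
  have h1 := exp_le_quadratic_add_cubic (l * min y x)
  have h2 : l * min y x ≤ l * y := by gcongr; exact min_le_left _ _
  have h3 : (l * min y x) ^ 2 / 2 ≤ l ^ 2 / 2 * y ^ 2 := by
    have := sq_le_sq.2 habs
    calc (l * min y x) ^ 2 / 2 = l ^ 2 / 2 * min y x ^ 2 := by ring
      _ ≤ _ := by gcongr
  have h4 : |l * min y x| ^ 3 * Real.exp (max (l * min y x) 0)
      ≤ l ^ 3 * (|y| ^ 3 * Real.exp (t / 2 * |y| ^ α)) := by
    rw [abs_mul, abs_of_pos hl, mul_pow, mul_assoc]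
    gcongr
  linarith

theorem integral_exp_mul_min_le (hα : 0 < α) (hα1 : α < 1) (ht : 0 < t)
    (hexp : Integrable (fun y => Real.exp (t * |y| ^ α)) ν) {w : ℝ} (hmean : ∫ y, y ∂ν ≤ 0)
    (hvar : ∫ y, y ^ 2 ∂ν ≤ w) {l x : ℝ} (hl : 0 < l) (hx : 0 < x)
    (hlx : l * x ^ (1 - α) ≤ t / 2) :
    Integrable (fun y => Real.exp (l * min y x)) ν ∧
    ∫ y, Real.exp (l * min y x) ∂ν ≤
      Real.exp (l ^ 2 * w / 2 + l ^ 3 * ∫ y, |y| ^ 3 * Real.exp (t / 2 * |y| ^ α) ∂ν) := by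
  have hi1 : Integrable (fun y : ℝ => y) ν := by
    simpa using integrable_pow_of_exp_rpow hα ht hexp 1
  have hi2 := integrable_pow_of_exp_rpow hα ht hexp 2
  have hi3 := integrable_pow_mul_exp_rpow hα ht hexp 3
  have hi0 : Integrable (fun y : ℝ => 1 + l * y) ν := (integrable_const 1).add (hi1.const_mul l)
  have hi02 : Integrable (fun y : ℝ => 1 + l * y + l ^ 2 / 2 * y ^ 2) ν :=
    hi0.add (hi2.const_mul _)
  have hib : Integrable (fun y : ℝ => 1 + l * y + l ^ 2 / 2 * y ^ 2
      + l ^ 3 * (|y| ^ 3 * Real.exp (t / 2 * |y| ^ α))) ν := hi02.add (hi3.const_mul _)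
  have hi : Integrable (fun y => Real.exp (l * min y x)) ν := by
    refine hib.mono' (by fun_prop) (Eventually.of_forall fun y => ?_)
    rw [Real.norm_of_nonneg (Real.exp_pos _).le]
    exact exp_mul_min_le hα hα1 hl hx hlx ht y
  refine ⟨hi, ?_⟩
  calc ∫ y, Real.exp (l * min y x) ∂ν
      ≤ ∫ y, 1 + l * y + l ^ 2 / 2 * y ^ 2
        + l ^ 3 * (|y| ^ 3 * Real.exp (t / 2 * |y| ^ α)) ∂ν :=
        integral_mono hi hib fun y => exp_mul_min_le hα hα1 hl hx hlx ht y
    _ = 1 + l * ∫ y, y ∂ν + l ^ 2 / 2 * ∫ y, y ^ 2 ∂ν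
        + l ^ 3 * ∫ y, |y| ^ 3 * Real.exp (t / 2 * |y| ^ α) ∂ν := by
        rw [integral_add hi02 (hi3.const_mul _), integral_add hi0 (hi2.const_mul _),
          integral_add (integrable_const 1) (hi1.const_mul l), integral_const_mul l (fun y : ℝ => y)]
        simp only [integral_const_mul, integral_const, probReal_univ, smul_eq_mul, mul_one]
    _ ≤ (l ^ 2 * w / 2 + l ^ 3 * ∫ y, |y| ^ 3 * Real.exp (t / 2 * |y| ^ α) ∂ν) + 1 := by
        have h1 : l * ∫ y, y ∂ν ≤ 0 := mul_nonpos_of_nonneg_of_nonpos hl.le hmean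
        have h2 : l ^ 2 / 2 * ∫ y, y ^ 2 ∂ν ≤ l ^ 2 / 2 * w := by gcongr
        linarith
    _ ≤ _ := Real.add_one_le_exp _

theorem measureReal_Ioi_le_exp_rpow (hα : 0 < α) (ht : 0 < t)
    (hexp : Integrable (fun y => Real.exp (t * |y| ^ α)) ν) {x : ℝ} (hx : 0 ≤ x) :
    ν.real (Set.Ioi x) ≤ (∫ y, Real.exp (t * |y| ^ α) ∂ν) * Real.exp (-(t * x ^ α)) := by
  have h := mul_meas_ge_le_integral_of_nonneg
    (Eventually.of_forall fun y => (Real.exp_pos (t * |y| ^ α)).le) hexp (Real.exp (t * x ^ α))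
  have h2 : ν.real (Set.Ioi x) ≤ ν.real {y | Real.exp (t * x ^ α) ≤ Real.exp (t * |y| ^ α)} := by
    refine measureReal_mono fun y (hy : x < y) => ?_
    refine Real.exp_le_exp.2 (mul_le_mul_of_nonneg_left ?_ ht.le)
    exact Real.rpow_le_rpow hx (hy.le.trans (le_abs_self y)) hα.le
  rw [Real.exp_neg, ← div_eq_mul_inv, le_div_iff₀ (Real.exp_pos _), mul_comm]
  exact (mul_le_mul_of_nonneg_left h2 (Real.exp_pos _).le).trans h

variable {Ω : Type*} [MeasurableSpace Ω]

/-- Moderate deviation upper bound for the maximal partial sum of i.i.d. variables with a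
stretched exponential moment. -/
theorem exists_max_sum_tail_le (P : Measure Ω) [IsProbabilityMeasure P]
    (hα : 0 < α) (hα1 : α < 1) (ht : 0 < t)
    (hexp : Integrable (fun y => Real.exp (t * |y| ^ α)) ν) {w ε : ℝ} (hw : 0 < w) (hε : 0 < ε)
    (hmean : ∫ y, y ∂ν ≤ 0) (hvar : ∫ y, y ^ 2 ∂ν ≤ w) :
    ∃ η > 0, ∃ C > 0, ∀ Y : ℕ → Ω → ℝ, IIDSeq Y ν P → ∀ N : ℕ, 1 ≤ N → ∀ x : ℝ, √N ≤ x →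
      x ^ (2 - α) ≤ η * N →
      P.real {ω | ∃ n ≤ N, x ≤ ∑ k ∈ Finset.range n, Y k ω} ≤
        C * Real.exp (-((1 - ε) * (x ^ 2 / (2 * w * N)))) := by
  obtain ⟨K, hK, hKs⟩ := exists_pow_le_mul_exp_rpow hα (half_pos ht) 2
  set D := ∫ y, |y| ^ 3 * Real.exp (t / 2 * |y| ^ α) ∂ν with hD
  set M := ∫ y, Real.exp (t * |y| ^ α) ∂ν with hM
  have hD0 : 0 ≤ D := integral_nonneg fun y => by positivity
  have hM0 : 0 ≤ M := integral_nonneg fun y => by positivity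
  -- The first bound on `x ^ (2 - α) / N` makes `l = x / (N w)` admissible for truncation at `x`;
  -- the second keeps the cubic term below a fraction `ε` of the Gaussian exponent. In the constant,
  -- `1` comes from the truncated sums and `K * M` from single jumps above `x`.
  refine ⟨min (t * w / 2) (ε * w ^ 2 / (2 * (D + 1))), by positivity, 1 + K * M, by positivity,
    fun Y hY N hN x hx hxη => ?_⟩
  have hN0 : (0 : ℝ) < N := by exact_mod_cast hN
  have hx1 : 1 ≤ x := le_trans (by rw [Real.one_le_sqrt]; exact_mod_cast hN) hx
  have hx0 : 0 < x := by linarith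
  have hxN : N ≤ x ^ 2 := (Real.sqrt_le_left hx0.le).1 hx
  have hη1 : x ^ (2 - α) ≤ t * w / 2 * N := hxη.trans (by gcongr; exact min_le_left _ _)
  have hη2 : x ≤ ε * w ^ 2 / (2 * (D + 1)) * N := by
    calc x = x ^ (1 : ℝ) := (Real.rpow_one x).symm
      _ ≤ x ^ (2 - α) := Real.rpow_le_rpow_of_exponent_le hx1 (by linarith)
      _ ≤ _ := hxη.trans (by gcongr; exact min_le_right _ _)
  -- The minimiser of the Gaussian exponent `N l² w / 2 - l x`.
  set l := x / (N * w) with hl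
  have hl0 : 0 < l := by positivity
  have hlx : l * x ^ (1 - α) ≤ t / 2 := by
    have : x * x ^ (1 - α) = x ^ (2 - α) := by
      rw [← Real.rpow_one_add' hx0.le (by linarith)]; ring_nf
    rw [hl, div_mul_eq_mul_div, this, div_le_iff₀ (by positivity)]
    linarith
  obtain ⟨hint, hle⟩ := integral_exp_mul_min_le hα hα1 ht hexp hmean hvar hl0 hx0 hlx
  have hmin : ∀ _ : ℕ, Measurable fun y : ℝ => min y x := fun _ => by fun_prop
  have h1 := measureReal_exists_le_sum_le (P := P) (Y := fun k ω => min (Y k ω) x)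
    (fun k => (hmin k).comp (hY.measurable k)) (hY.indep.comp _ hmin) hl0
    (b := l ^ 2 * w / 2 + l ^ 3 * D) (by positivity)
    (fun k => hY.integrable_comp hint k)
    (fun k => by
      rw [hY.integral_comp (f := fun y => Real.exp (l * min y x)) (by fun_prop)]; exact hle) x N
  have h1' : N * (l ^ 2 * w / 2 + l ^ 3 * D) - l * x ≤ -((1 - ε) * (x ^ 2 / (2 * w * N))) := by
    have e1 : N * (l ^ 2 * w / 2 + l ^ 3 * D) - l * x
        = x ^ 2 / (2 * w * N) * (2 * D * x / (N * w ^ 2) - 1) := by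
      rw [hl]; field_simp; ring
    have e2 : 2 * D * x / (N * w ^ 2) ≤ ε := by
      rw [div_le_iff₀ (by positivity)]
      calc 2 * D * x ≤ 2 * (D + 1) * (ε * w ^ 2 / (2 * (D + 1)) * N) := by gcongr; linarith
        _ = ε * (N * w ^ 2) := by field_simp
    have e3 : 0 ≤ x ^ 2 / (2 * w * N) := by positivity
    rw [e1]
    nlinarith
  -- The factor `N ≤ x²` of the union bound costs half of the decay `exp (-t x^α)`; the rest still
  -- beats the Gaussian term, as `x² = x^(2-α) x^α` and `x^(2-α) ≤ t w N`.
  have h2 : N * ν.real (Set.Ioi x) ≤ K * M * Real.exp (-((1 - ε) * (x ^ 2 / (2 * w * N)))) := by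
    have e1 := measureReal_Ioi_le_exp_rpow hα ht hexp hx0.le
    have e2 : x ^ 2 / (2 * w * N) ≤ t / 2 * x ^ α := by
      have : x ^ 2 = x ^ (2 - α) * x ^ α := by
        rw [← Real.rpow_add hx0, ← Real.rpow_natCast]; norm_num
      rw [div_le_iff₀ (by positivity), this]
      have h5 : 0 ≤ x ^ α := by positivity
      have h6 : x ^ (2 - α) ≤ t * w * N := hη1.trans (by nlinarith [mul_pos (mul_pos ht hw) hN0])
      nlinarith
    have e3 : 0 ≤ x ^ 2 / (2 * w * N) := by positivity
    calc N * ν.real (Set.Ioi x) ≤ (K * Real.exp (t / 2 * x ^ α)) * (M * Real.exp (-(t * x ^ α))) := by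
          gcongr
          exact hxN.trans (hKs x hx0.le)
      _ = K * M * Real.exp (-(t / 2 * x ^ α)) := by
          rw [mul_mul_mul_comm, ← Real.exp_add]; ring_nf
      _ ≤ _ := by
          refine mul_le_mul_of_nonneg_left (Real.exp_le_exp.2 ?_) (by positivity)
          nlinarith
  have hsub : {ω | ∃ n ≤ N, x ≤ ∑ k ∈ Finset.range n, Y k ω} ⊆
      {ω | ∃ n ≤ N, x ≤ ∑ k ∈ Finset.range n, min (Y k ω) x}
        ∪ ⋃ k ∈ Finset.range N, {ω | Y k ω ∈ Set.Ioi x} := by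
    rintro ω ⟨n, hn, h⟩
    by_cases hb : ∃ k ∈ Finset.range N, x < Y k ω
    · right
      obtain ⟨k, hk, hk'⟩ := hb
      exact Set.mem_biUnion hk hk'
    · left
      push Not at hb
      refine ⟨n, hn, h.trans_eq (Finset.sum_congr rfl fun k hk => ?_)⟩
      rw [min_eq_left (hb k (Finset.mem_range.2 ((Finset.mem_range.1 hk).trans_le hn)))]
  calc P.real {ω | ∃ n ≤ N, x ≤ ∑ k ∈ Finset.range n, Y k ω}
      ≤ P.real {ω | ∃ n ≤ N, x ≤ ∑ k ∈ Finset.range n, min (Y k ω) x}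
        + ∑ k ∈ Finset.range N, P.real {ω | Y k ω ∈ Set.Ioi x} :=
        (measureReal_mono hsub).trans ((measureReal_union_le _ _).trans
          (add_le_add le_rfl (measureReal_biUnion_finset_le _ _)))
    _ = P.real {ω | ∃ n ≤ N, x ≤ ∑ k ∈ Finset.range n, min (Y k ω) x} + N * ν.real (Set.Ioi x) := by
        simp only [hY.measureReal_preimage measurableSet_Ioi, Finset.sum_const, Finset.card_range,
          nsmul_eq_mul]
    _ ≤ Real.exp (-((1 - ε) * (x ^ 2 / (2 * w * N))))
        + K * M * Real.exp (-((1 - ε) * (x ^ 2 / (2 * w * N)))) :=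
        add_le_add (h1.trans (Real.exp_le_exp.2 h1')) h2
    _ = _ := by ring

end StretchedExponential

/-! ### Moderate deviations, lower bound. -/

theorem ProbabilityTheory.iIndepFun.indepFun_sum_sum {Ω ι : Type*} [MeasurableSpace Ω]
    {P : Measure Ω} {Y : ι → Ω → ℝ} (hi : iIndepFun Y P) (hm : ∀ k, Measurable (Y k))
    {S T : Finset ι} (hST : Disjoint S T) :
    IndepFun (fun ω => ∑ k ∈ S, Y k ω) (fun ω => ∑ k ∈ T, Y k ω) P := by
  have h := hi.indepFun_finset S T hST hm
  have := h.comp (φ := fun z : S → ℝ => ∑ i, z i) (ψ := fun z : T → ℝ => ∑ i, z i)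
    (by fun_prop) (by fun_prop)
  convert! this using 1
  · ext ω; simp [Finset.sum_attach S fun k => Y k ω]
  · ext ω; simp [Finset.sum_attach T fun k => Y k ω]

namespace IIDSeq

variable {Ω Ω' : Type*} [MeasurableSpace Ω] [MeasurableSpace Ω'] {Y : ℕ → Ω → ℝ}
  {Y' : ℕ → Ω' → ℝ} {ν : Measure ℝ} {P : Measure Ω} {P' : Measure Ω'}

theorem measurable_sum (h : IIDSeq Y ν P) (S : Finset ℕ) :
    Measurable fun ω => ∑ k ∈ S, Y k ω :=
  Finset.measurable_sum _ fun k _ => h.measurable k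

theorem map_sum_succ [IsProbabilityMeasure P] (h : IIDSeq Y ν P) (n : ℕ) :
    P.map (fun ω => ∑ k ∈ Finset.range (n + 1), Y k ω)
      = (P.map (fun ω => ∑ k ∈ Finset.range n, Y k ω)) ∗ ν := by
  have hi := h.indep.indepFun_sum_sum h.measurable (S := Finset.range n) (T := {n}) (by simp)
  simp only [Finset.sum_singleton] at hi
  have := hi.map_add_eq_map_conv_map (h.measurable_sum _) (h.measurable n)
  rw [h.law n] at this
  rw [← this]
  congr 1
  ext ω
  simp [Finset.sum_range_succ]

/-- This carries a CLT threshold found for one reference sequence to every sequence with the same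
law, so that the bounds are uniform over pairs of rows. -/
theorem map_sum_eq [IsProbabilityMeasure P] [IsProbabilityMeasure P'] (h : IIDSeq Y ν P)
    (h' : IIDSeq Y' ν P') (n : ℕ) :
    P.map (fun ω => ∑ k ∈ Finset.range n, Y k ω)
      = P'.map (fun ω => ∑ k ∈ Finset.range n, Y' k ω) := by
  induction n with
  | zero => simp [Measure.map_const]
  | succ n ih => rw [h.map_sum_succ, h'.map_sum_succ, ih]

end IIDSeq

/-- On `(y, y + 1]` the density is at least its value at `y + 1`. The loss in the exponent is linear
in `y`, so `ε y² / 2` dominates it once `ε y ≥ 5` and `y ≥ 1`. -/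
theorem exists_exp_lt_gaussianReal_Ioi {ε : ℝ} (hε : 0 < ε) :
    ∃ y : ℝ, 0 < y ∧
      ENNReal.ofReal (Real.exp (-((1 + ε) * (y ^ 2 / 2)))) < gaussianReal 0 1 (Set.Ioi y) := by
  set y : ℝ := 1 + 5 / ε with hy
  have hε5 : 0 < 5 / ε := by positivity
  have hy1 : 1 < y := by linarith
  have hεy : 5 ≤ ε * y := by
    rw [hy, mul_add, mul_div_cancel₀ _ hε.ne']; linarith
  refine ⟨y, by linarith, ?_⟩
  have hpi : √(2 * Real.pi) < Real.exp 1 := by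
    rw [Real.sqrt_lt' (Real.exp_pos 1)]
    have := Real.exp_one_gt_d9
    have := Real.pi_lt_d2
    nlinarith
  have h1 : Real.exp (-((1 + ε) * (y ^ 2 / 2))) < (√(2 * Real.pi))⁻¹ * Real.exp (-(y + 1) ^ 2 / 2) := by
    rw [inv_mul_eq_div, lt_div_iff₀ (by positivity)]
    calc Real.exp (-((1 + ε) * (y ^ 2 / 2))) * √(2 * Real.pi)
        < Real.exp (-((1 + ε) * (y ^ 2 / 2))) * Real.exp 1 := by gcongr
      _ = Real.exp (-((1 + ε) * (y ^ 2 / 2)) + 1) := (Real.exp_add _ _).symm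
      _ ≤ _ := by
        apply Real.exp_le_exp.2
        nlinarith
  calc ENNReal.ofReal (Real.exp (-((1 + ε) * (y ^ 2 / 2))))
      < ENNReal.ofReal ((√(2 * Real.pi))⁻¹ * Real.exp (-(y + 1) ^ 2 / 2)) :=
        (ENNReal.ofReal_lt_ofReal_iff (by positivity)).2 h1
    _ = ∫⁻ _ in Set.Ioc y (y + 1),
        ENNReal.ofReal ((√(2 * Real.pi))⁻¹ * Real.exp (-(y + 1) ^ 2 / 2)) := by simp
    _ ≤ ∫⁻ x in Set.Ioc y (y + 1), gaussianPDF 0 1 x := by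
        refine setLIntegral_mono (by fun_prop) fun x hx => ENNReal.ofReal_le_ofReal ?_
        simp only [gaussianPDFReal, NNReal.coe_one, mul_one, sub_zero]
        gcongr
        · linarith [hx.1]
        · exact hx.2
    _ ≤ ∫⁻ x in Set.Ioi y, gaussianPDF 0 1 x :=
        lintegral_mono_set fun x hx => hx.1
    _ = gaussianReal 0 1 (Set.Ioi y) := (gaussianReal_apply 0 one_ne_zero _).symm

section LowerTail

variable {Ω : Type*} [MeasurableSpace Ω] {P : Measure Ω} [IsProbabilityMeasure P] {ν : Measure ℝ}
  {Y : ℕ → Ω → ℝ}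

theorem IIDSeq.eventually_lt_measure_sum (h : IIDSeq Y ν P) {v : ℝ} (hv : 0 < v)
    (hmean : ∫ y, y ∂ν = 0) (hvar : ∫ y, y ^ 2 ∂ν = v) (y : ℝ) {c : ENNReal}
    (hc : c < gaussianReal 0 1 (Set.Ioi y)) :
    ∀ᶠ n : ℕ in atTop, c < P {ω | y * √(n * v) ≤ ∑ k ∈ Finset.range n, Y k ω} := by
  have hm : ∀ _ : ℕ, Measurable fun y : ℝ => y / √v := fun _ => by fun_prop
  have hclt := tendstoInDistribution_inv_sqrt_mul_sum (P := P) (P' := gaussianReal 0 1)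
    (X := fun k ω => Y k ω / √v) (Y := id) ⟨aemeasurable_id, Measure.map_id⟩
    (by
      rw [integral_div, h.integral_comp (f := fun y => y) measurable_id, hmean, zero_div])
    (by
      simp only [Pi.pow_apply, div_pow, Real.sq_sqrt hv.le]
      rw [integral_div, h.integral_comp (f := fun y => y ^ 2) (by fun_prop), hvar, div_self hv.ne'])
    (h.indep.comp _ hm)
    (fun k => ⟨((h.measurable k).div_const _).aemeasurable,
      ((h.measurable 0).div_const _).aemeasurable, by
      have e : ∀ k, P.map (fun ω => Y k ω / √v) = ν.map (fun y => y / √v) := fun k => by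
        rw [← h.law k, Measure.map_map (hm 0) (h.measurable k)]; rfl
      rw [e, e]⟩)
  have hlim := ProbabilityMeasure.le_liminf_measure_open_of_tendsto hclt.tendsto
    (isOpen_Ioi (a := y))
  simp only [ProbabilityMeasure.coe_mk, Measure.map_id] at hlim
  have hev := eventually_lt_of_lt_liminf (hc.trans_le hlim)
  filter_upwards [hev, eventually_gt_atTop 0] with n hn hn0
  refine hn.trans_le ?_
  rw [Measure.map_apply (by
    exact (Finset.measurable_sum _ fun k _ => (h.measurable k).div_const _).const_mul _)
    measurableSet_Ioi]
  refine measure_mono fun ω hω => ?_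
  simp only [Set.mem_preimage, Set.mem_Ioi, ← Finset.sum_div] at hω
  have hn' : (0 : ℝ) < n := by exact_mod_cast hn0
  rw [inv_mul_eq_div, div_div, lt_div_iff₀ (by positivity)] at hω
  show y * √(n * v) ≤ _
  rw [Real.sqrt_mul hn'.le, mul_comm √(n : ℝ)]
  exact hω.le

/-- The `N` terms are cut into `L + 1` independent blocks, each exceeding `z`. All have length `b`
except the first, which takes the remainder; this is why `hb` concerns every `n ≥ b`. -/
theorem IIDSeq.pow_le_measureReal_sum (h : IIDSeq Y ν P) {r z : ℝ} {b : ℕ} (hr : 0 ≤ r)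
    (hb : ∀ n, b ≤ n → r ≤ P.real {ω | z ≤ ∑ k ∈ Finset.range n, Y k ω}) (L : ℕ) :
    ∀ N, (L + 1) * b ≤ N →
      r ^ (L + 1) ≤ P.real {ω | (L + 1) * z ≤ ∑ k ∈ Finset.range N, Y k ω} := by
  induction L with
  | zero => intro N hN; simpa using hb N (by simpa using hN)
  | succ L ih =>
    intro N hN
    obtain ⟨M, rfl⟩ : ∃ M, N = M + b := ⟨N - b, by
      have : b ≤ (L + 1 + 1) * b := Nat.le_mul_of_pos_left _ (by omega)
      omega⟩
    have hM : (L + 1) * b ≤ M := by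
      rw [add_mul (L + 1) 1 b] at hN; omega
    have hi := h.indep.indepFun_sum_sum h.measurable (S := Finset.range M)
      (T := Finset.Ico M (M + b)) (by
        rw [Finset.range_eq_Ico]; exact Finset.Ico_disjoint_Ico_consecutive 0 M _)
    have hsum : ∀ ω, ∑ k ∈ Finset.Ico M (M + b), Y k ω = ∑ k ∈ Finset.range b, Y (M + k) ω := by
      intro ω; rw [Finset.sum_Ico_eq_sum_range]; simp
    have hlast : r ≤ P.real {ω | z ≤ ∑ k ∈ Finset.Ico M (M + b), Y k ω} := by
      refine (hb b le_rfl).trans_eq ?_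
      have e := congrArg (fun μ => μ.real (Set.Ici z)) (h.map_sum_eq (h.shift M) b)
      beta_reduce at e
      rw [map_measureReal_apply (h.measurable_sum _) measurableSet_Ici,
        map_measureReal_apply ((h.shift M).measurable_sum _) measurableSet_Ici] at e
      simp only [hsum]
      exact e
    have hprod := congrArg ENNReal.toReal (hi.measure_inter_preimage_eq_mul _ _
      (measurableSet_Ici (a := (L + 1) * z)) (measurableSet_Ici (a := z)))
    rw [ENNReal.toReal_mul] at hprod
    calc r ^ (L + 1 + 1) = r ^ (L + 1) * r := pow_succ _ _
      _ ≤ P.real {ω | (L + 1) * z ≤ ∑ k ∈ Finset.range M, Y k ω}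
          * P.real {ω | z ≤ ∑ k ∈ Finset.Ico M (M + b), Y k ω} := by
          gcongr
          exact ih M hM
      _ = _ := hprod.symm
      _ ≤ _ := by
          refine measureReal_mono fun ω hω => ?_
          have h1 : (L + 1) * z ≤ ∑ k ∈ Finset.range M, Y k ω := hω.1
          have h2 : z ≤ ∑ k ∈ Finset.Ico M (M + b), Y k ω := hω.2
          show ((L + 1 : ℕ) + 1) * z ≤ ∑ k ∈ Finset.range (M + b), Y k ω
          rw [← Finset.sum_range_add_sum_Ico _ (Nat.le_add_right M b)]
          push_cast
          linarith

/-- Moderate deviation lower bound for sums of i.i.d. variables with finite variance. -/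
theorem exists_le_sum_tail (P : Measure Ω) [IsProbabilityMeasure P] {v ε : ℝ} (hv : 0 < v)
    (hε : 0 < ε) (hε1 : ε ≤ 1) (hmean : ∫ y, y ∂ν = 0) (hvar : ∫ y, y ^ 2 ∂ν = v)
    {Y₀ : ℕ → Ω → ℝ} (hY₀ : IIDSeq Y₀ ν P) :
    ∃ A > 0, ∃ η > 0, ∀ Y : ℕ → Ω → ℝ, IIDSeq Y ν P → ∀ N : ℕ, 1 ≤ N → ∀ x : ℝ, 0 ≤ x →
      A * N ≤ x ^ 2 → x ^ 2 ≤ η * N ^ 2 →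
      Real.exp (-((1 + ε) * (x ^ 2 / (2 * v * N)))) ≤
        P.real {ω | x ≤ ∑ k ∈ Finset.range N, Y k ω} := by
  obtain ⟨y, hy, hyγ⟩ := exists_exp_lt_gaussianReal_Ioi (ε := ε / 4) (by positivity)
  obtain ⟨b₀, hb₀⟩ := eventually_atTop.1 (hY₀.eventually_lt_measure_sum hv hmean hvar y hyγ)
  set r := Real.exp (-((1 + ε / 4) * (y ^ 2 / 2))) with hr
  -- The block count will satisfy `L ≤ κ N`. The first entry gives `N - L ≥ N / (1 + ε/4)`, so
  -- rounding the block length is harmless; the second makes blocks long enough for the CLT bound.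
  set κ := min (ε / 4 / (1 + ε / 4)) (1 / (b₀ + 1)) with hκ
  have hκ0 : 0 < κ := by positivity
  refine ⟨4 * v * y ^ 2 / ε, by positivity, κ * v * y ^ 2 / (1 + ε / 2), by positivity,
    fun Y hY N hN x hx hAx hxη => ?_⟩
  have hN0 : (0 : ℝ) < N := by exact_mod_cast hN
  -- Ideal number of blocks: the solution `L` of `x = L y √(v N / L)`. The factor `1 + ε/4` in `L`
  -- compensates for rounding, and `A` is chosen to give `s ≥ 4/ε`, so the ceiling adds at most `ε s
  -- / 4`.
  set s := x ^ 2 / (N * v * y ^ 2) with hs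
  have hs1 : 4 / ε ≤ s := by
    rw [hs, le_div_iff₀ (by positivity)]
    calc 4 / ε * (N * v * y ^ 2) = 4 * v * y ^ 2 / ε * N := by ring
      _ ≤ _ := hAx
  have hεs : 4 ≤ ε * s := by rwa [div_le_iff₀' hε] at hs1
  have hs0 : 0 < s := lt_of_lt_of_le (by positivity) hs1
  have hs2 : (1 + ε / 2) * s ≤ κ * N := by
    rw [hs, mul_div_assoc', div_le_iff₀ (by positivity)]
    calc (1 + ε / 2) * x ^ 2 ≤ (1 + ε / 2) * (κ * v * y ^ 2 / (1 + ε / 2) * N ^ 2) := by gcongr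
      _ = κ * N * (N * v * y ^ 2) := by field_simp
  set L := ⌈(1 + ε / 4) * s⌉₊ with hL
  have hL1 : (1 + ε / 4) * s ≤ L := Nat.le_ceil _
  have hL2 : (L : ℝ) ≤ (1 + ε / 2) * s := by
    have := (Nat.ceil_lt_add_one (a := (1 + ε / 4) * s) (by positivity)).le
    rw [← hL] at this
    linarith
  have hL0 : 0 < L := Nat.ceil_pos.2 (by positivity)
  have hL0' : (0 : ℝ) < L := by exact_mod_cast hL0
  have hLN : (L : ℝ) ≤ κ * N := hL2.trans hs2
  set b := N / L with hb
  have hbb₀ : b₀ ≤ b := by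
    rw [hb, Nat.le_div_iff_mul_le hL0]
    have : (L : ℝ) ≤ 1 / (b₀ + 1) * N := hLN.trans (by gcongr; exact min_le_right _ _)
    rw [one_div_mul_eq_div, le_div_iff₀ (by positivity)] at this
    have h2 : (b₀ * L : ℝ) ≤ N := by linarith
    exact_mod_cast h2
  have hbN : N ≤ L * b + L := by
    have := Nat.div_add_mod N L
    have := Nat.mod_lt N hL0
    rw [hb]; omega
  have hbN' : (N : ℝ) ≤ L * b + L := by exact_mod_cast hbN
  obtain ⟨L', hL'⟩ : ∃ L', L = L' + 1 := ⟨L - 1, by omega⟩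
  set z := y * √(b * v) with hz
  have hpow := hY.pow_le_measureReal_sum (r := r) (z := z) (b := b) (Real.exp_pos _).le
    (fun n hn => by
      have h1 := (hb₀ n (hbb₀.trans hn)).le
      have h2 : P {ω | y * √(n * v) ≤ ∑ k ∈ Finset.range n, Y₀ k ω}
          = P {ω | y * √(n * v) ≤ ∑ k ∈ Finset.range n, Y k ω} := by
        have e := congrArg (fun μ => μ (Set.Ici (y * √(n * v)))) (hY₀.map_sum_eq hY n)
        beta_reduce at e
        rwa [Measure.map_apply (hY₀.measurable_sum _) measurableSet_Ici,
          Measure.map_apply (hY.measurable_sum _) measurableSet_Ici] at e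
      rw [h2] at h1
      have h3 := ENNReal.toReal_mono (measure_ne_top _ _) h1
      rw [ENNReal.toReal_ofReal (Real.exp_pos _).le] at h3
      refine h3.trans (measureReal_mono fun ω (hω : y * √(n * v) ≤ _) => ?_)
      refine le_trans ?_ hω
      rw [hz]
      gcongr) L' N (by rw [← hL', hb]; exact Nat.mul_div_le N L)
  have hLcast : ((L' : ℝ) + 1) = L := by rw [hL']; push_cast; ring
  rw [← hL', hLcast] at hpow
  have hxz : x ≤ L * z := by
    refine abs_le_of_sq_le_sq' ?_ (by positivity) |>.2
    rw [hz, mul_pow, mul_pow, Real.sq_sqrt (by positivity)]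
    have hx2 : x ^ 2 = s * N * (v * y ^ 2) := by rw [hs]; field_simp
    have h1 : s * N ≤ L ^ 2 * b := by
      have hk : (L : ℝ) * (1 + ε / 4) ≤ ε / 4 * N := by
        have : (L : ℝ) ≤ ε / 4 / (1 + ε / 4) * N := hLN.trans (by gcongr; exact min_le_left _ _)
        rwa [div_mul_eq_mul_div, le_div_iff₀ (by positivity)] at this
      have h2 : (L : ℝ) * (N - L) ≤ L ^ 2 * b := by nlinarith
      have h3 : N / (1 + ε / 4) ≤ N - L := by
        rw [div_le_iff₀ (by positivity)]; linarith
      calc s * N = ((1 + ε / 4) * s) * (N / (1 + ε / 4)) := by field_simp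
        _ ≤ L * (N - L) := by gcongr
        _ ≤ _ := h2
    rw [hx2]
    calc s * N * (v * y ^ 2) ≤ L ^ 2 * b * (v * y ^ 2) := by gcongr
      _ = _ := by ring
  calc Real.exp (-((1 + ε) * (x ^ 2 / (2 * v * N)))) ≤ r ^ L := by
        rw [hr, ← Real.exp_nat_mul]
        apply Real.exp_le_exp.2
        have hx2 : x ^ 2 / (2 * v * N) = s * (y ^ 2 / 2) := by rw [hs]; field_simp
        rw [hx2]
        have h1 : (1 + ε / 4) * L ≤ (1 + ε) * s := by nlinarith
        have h2 : 0 ≤ y ^ 2 / 2 := by positivity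
        nlinarith
    _ ≤ _ := hpow
    _ ≤ _ := measureReal_mono fun ω (hω : L * z ≤ _) => hxz.trans hω

end LowerTail

/-! ### Independence of rows and columns of an array. -/

/-- The joint law is a product measure, and currying turns it into a product of product measures.
Whole rows, or whole columns after a swap, are thereby independent. -/
theorem ProbabilityTheory.iIndepFun.curry {Ω ι κ : Type*} [MeasurableSpace Ω]
    {P : Measure Ω} {X : ι → κ → Ω → ℝ} (hm : ∀ i k, Measurable (X i k))
    (hi : iIndepFun (fun p : ι × κ => X p.1 p.2) P) :
    iIndepFun (fun i ω k => X i k ω) P := by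
  have := hi.isProbabilityMeasure
  have hprob : ∀ i j, IsProbabilityMeasure (P.map (X i j)) :=
    fun i j => Measure.isProbabilityMeasure_map (hm i j).aemeasurable
  rw [iIndepFun_iff_map_fun_eq_infinitePi_map (by fun_prop)]
  have h1 := hi.map_fun_eq_infinitePi_map (fun p : ι × κ => hm p.1 p.2)
  have h2 : ∀ i, P.map (fun ω k => X i k ω) = Measure.infinitePi fun k => P.map (X i k) := by
    intro i
    exact (hi.precomp (g := fun k : κ => (i, k)) (Prod.mk_right_injective i)).map_fun_eq_infinitePi_map
      (fun k => hm i k)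
  simp only [h2]
  rw [← Measure.infinitePi_map_curry (fun i j => P.map (X i j)), ← h1,
    Measure.map_map (by fun_prop) (by fun_prop)]
  rfl

/-- An array of independent random variables with common law `μ`. -/
structure IIDArray {Ω : Type*} [MeasurableSpace Ω] (X : ℕ → ℕ → Ω → ℝ) (μ : Measure ℝ)
    (P : Measure Ω) : Prop where
  measurable : ∀ i k, Measurable (X i k)
  indep : iIndepFun (fun ik : ℕ × ℕ => X ik.1 ik.2) P
  law : ∀ i k, P.map (X i k) = μ

namespace IIDArray

variable {Ω : Type*} [MeasurableSpace Ω] {X : ℕ → ℕ → Ω → ℝ} {μ : Measure ℝ} {P : Measure Ω}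

theorem map_rows (h : IIDArray X μ P) {d : ℕ} {r : Fin d → ℕ} (hr : Function.Injective r)
    (k : ℕ) : P.map (fun ω s => X (r s) k ω) = Measure.pi fun _ : Fin d => μ := by
  have hk := h.indep.precomp (g := fun s : Fin d => (r s, k)) fun s s' hs =>
    hr (congrArg Prod.fst hs)
  have := hk.map_fun_eq_pi_map fun s => (h.measurable (r s) k).aemeasurable
  simpa [h.law] using this

/-- A function of finitely many distinct rows, applied column by column. -/
theorem comp_rows (h : IIDArray X μ P) {d : ℕ} {r : Fin d → ℕ} (hr : Function.Injective r)
    {g : (Fin d → ℝ) → ℝ} (hg : Measurable g) :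
    IIDSeq (fun k ω => g fun s => X (r s) k ω) ((Measure.pi fun _ : Fin d => μ).map g) P where
  measurable k := hg.comp (measurable_pi_lambda _ fun s => h.measurable (r s) k)
  indep := by
    have hswap := h.indep.precomp (g := fun p : ℕ × ℕ => (p.2, p.1)) Prod.swap_injective
    have hcol := iIndepFun.curry (X := fun k i => X i k) (fun k i => h.measurable i k) hswap
    exact hcol.comp (fun _ (z : ℕ → ℝ) => g fun s => z (r s)) fun _ => by fun_prop
  law k := by
    rw [← h.map_rows hr k, Measure.map_map hg
      (measurable_pi_lambda _ fun s => h.measurable (r s) k)]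
    rfl

theorem indepFun_rows (h : IIDArray X μ P) {i j i' j' : ℕ} (h1 : i ≠ i') (h2 : i ≠ j')
    (h3 : j ≠ i') (h4 : j ≠ j') {f : (ℕ → ℝ) × (ℕ → ℝ) → ℝ} (hf : Measurable f) :
    IndepFun (fun ω => f (fun k => X i k ω, fun k => X j k ω))
      (fun ω => f (fun k => X i' k ω, fun k => X j' k ω)) P := by
  have hrow := h.indep.curry h.measurable
  exact (hrow.indepFun_prodMk_prodMk
    (fun i => measurable_pi_lambda _ fun k => h.measurable i k) i j i' j' h1 h2 h3 h4).comp hf hf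

end IIDArray

/-! ### The second moment method. -/

/-- The second moment method: if none of the events `E a` occurs, the number of occurrences
deviates from its mean. -/
theorem measureReal_inter_compl_mul_sq_le {Ω ι : Type*} [MeasurableSpace Ω] {P : Measure Ω}
    [IsProbabilityMeasure P] [Fintype ι] {E : ι → Set Ω} (hE : ∀ a, MeasurableSet (E a)) {q : ℝ}
    (hq : ∀ a, P.real (E a) = q) :
    P.real {ω | ∀ a, ω ∉ E a} * (Fintype.card ι * q) ^ 2
      ≤ ∑ a, ∑ b, (P.real (E a ∩ E b) - q ^ 2) := by
  set f : ι → Ω → ℝ := fun a => (E a).indicator 1 with hf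
  have hfi : ∀ a, Integrable (f a) P := fun a => (integrable_const 1).indicator (hE a)
  have hff : ∀ a b, (fun ω => f a ω * f b ω) = (E a ∩ E b).indicator 1 := by
    intro a b
    ext ω
    simp only [hf, Set.inter_indicator_one, Pi.mul_apply]
  have hffi : ∀ a b, Integrable (fun ω => f a ω * f b ω) P := by
    intro a b
    rw [hff]
    exact (integrable_const 1).indicator ((hE a).inter (hE b))
  have hfint : ∀ a, ∫ ω, f a ω ∂P = q := fun a => by
    rw [integral_indicator_one (hE a), hq]
  have hffint : ∀ a b, ∫ ω, f a ω * f b ω ∂P = P.real (E a ∩ E b) := fun a b => by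
    rw [hff, integral_indicator_one ((hE a).inter (hE b))]
  have hexp : ∀ a b ω, (f a ω - q) * (f b ω - q)
      = f a ω * f b ω - q * f a ω - q * f b ω + q ^ 2 := fun a b ω => by ring
  have hprod : ∀ a b, Integrable (fun ω => (f a ω - q) * (f b ω - q)) P := fun a b => by
    simp only [hexp]
    exact (((hffi a b).sub ((hfi a).const_mul q)).sub ((hfi b).const_mul q)).add
      (integrable_const _)
  have hcov : ∀ a b, ∫ ω, (f a ω - q) * (f b ω - q) ∂P = P.real (E a ∩ E b) - q ^ 2 := by
    intro a b
    have i1 : Integrable (fun ω => f a ω * f b ω - q * f a ω) P :=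
      (hffi a b).sub ((hfi a).const_mul q)
    have i2 : Integrable (fun ω => f a ω * f b ω - q * f a ω - q * f b ω) P :=
      i1.sub ((hfi b).const_mul q)
    simp only [hexp]
    rw [integral_add i2 (integrable_const _), integral_sub i1 ((hfi b).const_mul q),
      integral_sub (hffi a b) ((hfi a).const_mul q), integral_const_mul, integral_const_mul,
      hffint, hfint, hfint]
    simp only [integral_const, probReal_univ, smul_eq_mul]
    ring
  have hsq : ∀ ω, (∑ a, (f a ω - q)) ^ 2 = ∑ a, ∑ b, (f a ω - q) * (f b ω - q) := fun ω => by
    rw [sq, Finset.sum_mul_sum]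
  have hset : MeasurableSet {ω | ∀ a, ω ∉ E a} := by
    simp only [Set.ofPred_forall]
    exact MeasurableSet.iInter fun a => (hE a).compl
  calc P.real {ω | ∀ a, ω ∉ E a} * (Fintype.card ι * q) ^ 2
      = ∫ ω, {ω | ∀ a, ω ∉ E a}.indicator (fun _ => (Fintype.card ι * q) ^ 2) ω ∂P := by
        rw [integral_indicator_const _ hset, smul_eq_mul]
    _ ≤ ∫ ω, (∑ a, (f a ω - q)) ^ 2 ∂P := by
        refine integral_mono ((integrable_const _).indicator hset) ?_ fun ω => ?_
        · simp only [hsq]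
          exact integrable_finsetSum _ fun a _ => integrable_finsetSum _ fun b _ => hprod a b
        · by_cases hω : ∀ a, ω ∉ E a
          · have h0 : ∀ a, f a ω = 0 := fun a => Set.indicator_of_notMem (hω a) _
            simp [h0, hω]
          · simp only [Set.indicator, Set.mem_ofPred_eq, hω, if_false]
            positivity
    _ = ∑ a, ∑ b, (P.real (E a ∩ E b) - q ^ 2) := by
        simp only [hsq]
        rw [integral_finsetSum _ fun a _ => integrable_finsetSum _ fun b _ => hprod a b]
        refine Finset.sum_congr rfl fun a _ => ?_
        rw [integral_finsetSum _ fun b _ => hprod a b]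
        exact Finset.sum_congr rfl fun b _ => hcov a b

/-- The second moment method for events indexed by a grid, independent unless they share a row or
a column. -/
theorem measureReal_forall_notMem_grid_le {Ω : Type*} [MeasurableSpace Ω] {P : Measure Ω}
    [IsProbabilityMeasure P] {h : ℕ} (hh : 0 < h) {E : Fin h × Fin h → Set Ω}
    (hE : ∀ a, MeasurableSet (E a)) {q q₂ : ℝ} (hq0 : 0 < q) (hq₂ : 0 ≤ q₂)
    (hq : ∀ a, P.real (E a) = q)
    (hind : ∀ a b : Fin h × Fin h, a.1 ≠ b.1 → a.2 ≠ b.2 → P.real (E a ∩ E b) = q ^ 2)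
    (hdep : ∀ a b : Fin h × Fin h, a ≠ b → a.1 = b.1 ∨ a.2 = b.2 → P.real (E a ∩ E b) ≤ q₂) :
    P.real {ω | ∀ a, ω ∉ E a} ≤ 1 / (h ^ 2 * q) + 2 * q₂ / (h * q ^ 2) := by
  have hh' : (0 : ℝ) < h := by exact_mod_cast hh
  have hmain := measureReal_inter_compl_mul_sq_le (P := P) hE hq
  have hbound : ∀ a b : Fin h × Fin h, P.real (E a ∩ E b) - q ^ 2 ≤
      (if a = b then q else 0)
        + ((if a.1 = b.1 then q₂ else 0) + (if a.2 = b.2 then q₂ else 0)) := by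
    intro a b
    have hqsq := sq_nonneg q
    by_cases hab : a = b
    · subst hab
      simp only [Set.inter_self, hq, if_true]
      linarith
    · by_cases h1 : a.1 = b.1
      · have := hdep a b hab (Or.inl h1)
        simp only [hab, h1, if_true, if_false]
        split_ifs <;> linarith
      · by_cases h2 : a.2 = b.2
        · have := hdep a b hab (Or.inr h2)
          simp only [hab, h1, h2, if_true, if_false]
          linarith
        · rw [hind a b h1 h2]
          simp [hab, h1, h2]
  have hsum : ∑ a : Fin h × Fin h, ∑ b : Fin h × Fin h, (P.real (E a ∩ E b) - q ^ 2)
      ≤ h ^ 2 * q + 2 * h ^ 3 * q₂ := by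
    refine (Finset.sum_le_sum fun a _ => Finset.sum_le_sum fun b _ => hbound a b).trans_eq ?_
    have hB : ∀ a : Fin h × Fin h, ∑ b : Fin h × Fin h, (if a.1 = b.1 then q₂ else 0) = h * q₂ := by
      intro a
      rw [Fintype.sum_prod_type_right]
      simp
    have hC : ∀ a : Fin h × Fin h, ∑ b : Fin h × Fin h, (if a.2 = b.2 then q₂ else 0) = h * q₂ := by
      intro a
      rw [Fintype.sum_prod_type]
      simp
    simp only [Finset.sum_add_distrib, hB, hC]
    simp
    ring
  have hcard : ((Fintype.card (Fin h × Fin h) : ℕ) : ℝ) = h ^ 2 := by simp [sq]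
  rw [hcard] at hmain
  have h3 : P.real {ω | ∀ a, ω ∉ E a} ≤ (h ^ 2 * q + 2 * h ^ 3 * q₂) / (h ^ 2 * q) ^ 2 := by
    rw [le_div_iff₀ (by positivity)]
    exact hmain.trans hsum
  refine h3.trans_eq ?_
  field_simp

/-! ### Moments of the centered squared distances. -/

/-- `f` is integrable with integral `r`. -/
def HasMean {Ω : Type*} [MeasurableSpace Ω] (P : Measure Ω) (f : Ω → ℝ) (r : ℝ) : Prop :=
  Integrable f P ∧ ∫ ω, f ω ∂P = r

namespace HasMean

variable {Ω : Type*} [MeasurableSpace Ω] {P : Measure Ω} {f g : Ω → ℝ} {r s : ℝ}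

theorem add (hf : HasMean P f r) (hg : HasMean P g s) :
    HasMean P (fun ω => f ω + g ω) (r + s) :=
  ⟨hf.1.add hg.1, by rw [integral_add hf.1 hg.1, hf.2, hg.2]⟩

theorem const_mul (hf : HasMean P f r) (c : ℝ) : HasMean P (fun ω => c * f ω) (c * r) :=
  ⟨hf.1.const_mul c, by rw [integral_const_mul, hf.2]⟩

theorem congr' (hf : HasMean P f r) (h : ∀ ω, g ω = f ω) (hr : s = r) : HasMean P g s := by
  rw [hr, show g = f from funext h]; exact hf

theorem const [IsProbabilityMeasure P] (c : ℝ) : HasMean P (fun _ => c) c :=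
  ⟨integrable_const c, by simp⟩

end HasMean

/-- The centered squared distance between two reals. -/
def sqDiff (c x y : ℝ) : ℝ := (x - y) ^ 2 - c

theorem measurable_sqDiff_uncurry (c : ℝ) : Measurable fun p : ℝ × ℝ => sqDiff c p.1 p.2 := by
  unfold sqDiff; fun_prop

section Moments

variable {Ω : Type*} [MeasurableSpace Ω] {P : Measure Ω} {A B : Ω → ℝ} {m c₂ c₄ : ℝ}

theorem HasMean.pow_mul_pow (hA : ∀ k : ℕ, Integrable (fun ω => (A ω - m) ^ k) P)
    (hB : ∀ k : ℕ, Integrable (fun ω => (B ω - m) ^ k) P)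
    (hi : IndepFun A B P) (j k : ℕ) :
    HasMean P (fun ω => (A ω - m) ^ j * (B ω - m) ^ k)
      ((∫ ω, (A ω - m) ^ j ∂P) * ∫ ω, (B ω - m) ^ k ∂P) := by
  have h := hi.comp (φ := fun x => (x - m) ^ j) (ψ := fun x => (x - m) ^ k)
    (by fun_prop) (by fun_prop)
  exact ⟨h.integrable_mul (hA j) (hB k), h.integral_fun_mul_eq_mul_integral
    (hA j).aestronglyMeasurable (hB k).aestronglyMeasurable⟩

/-- Expand in powers of `A - m` and `B - m`: monomials with a first power vanish, and the variance
is `(2c₄ + 6c₂²) - (2c₂)²`. -/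
theorem HasMean.sqDiff_and_sq [IsProbabilityMeasure P]
    (hA : ∀ k : ℕ, Integrable (fun ω => (A ω - m) ^ k) P)
    (hB : ∀ k : ℕ, Integrable (fun ω => (B ω - m) ^ k) P) (hi : IndepFun A B P)
    (hA1 : ∫ ω, (A ω - m) ∂P = 0) (hB1 : ∫ ω, (B ω - m) ∂P = 0)
    (hA2 : ∫ ω, (A ω - m) ^ 2 ∂P = c₂) (hB2 : ∫ ω, (B ω - m) ^ 2 ∂P = c₂)
    (hA4 : ∫ ω, (A ω - m) ^ 4 ∂P = c₄) (hB4 : ∫ ω, (B ω - m) ^ 4 ∂P = c₄) :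
    HasMean P (fun ω => sqDiff (2 * c₂) (A ω) (B ω)) 0 ∧
      HasMean P (fun ω => sqDiff (2 * c₂) (A ω) (B ω) ^ 2) (2 * (c₄ + c₂ ^ 2)) := by
  have H := HasMean.pow_mul_pow hA hB hi
  constructor
  · refine ((((H 2 0).add (H 0 2)).add ((H 1 1).const_mul (-2))).add
      (HasMean.const (-(2 * c₂)))).congr' (fun ω => ?_) ?_
    · simp only [sqDiff]; ring
    · simp [hA1, hA2, hB2]; ring
  · refine ((((((((H 4 0).add (H 0 4)).add ((H 3 1).const_mul (-4))).add
      ((H 1 3).const_mul (-4))).add ((H 2 2).const_mul 6)).add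
      (((H 2 0).add (H 0 2)).const_mul (-(4 * c₂)))).add ((H 1 1).const_mul (8 * c₂))).add
      (HasMean.const (4 * c₂ ^ 2))).congr' (fun ω => ?_) ?_
    · simp only [sqDiff]; ring
    · simp [hA1, hB1, hA2, hB2, hA4, hB4]; ring

end Moments

/-- Subadditivity of `s ↦ s^α` and of `s ↦ s^(2α)`; the latter needs `α ≤ 1/2`. -/
theorem abs_sqDiff_rpow_le {α c : ℝ} (hα : 0 < α) (hα' : α ≤ 1 / 2) (hc : 0 ≤ c) (x y : ℝ) :
    |sqDiff c x y| ^ α ≤ |x| ^ (2 * α) + |y| ^ (2 * α) + c ^ α := by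
  have h1 : |sqDiff c x y| ≤ |x - y| ^ 2 + c := by
    rw [sqDiff, ← sq_abs (x - y)]
    refine (abs_sub _ _).trans_eq ?_
    rw [abs_of_nonneg (by positivity), abs_of_nonneg hc]
  have h2 : (|x - y| ^ 2) ^ α = |x - y| ^ (2 * α) := by
    rw [← Real.rpow_natCast, ← Real.rpow_mul (abs_nonneg _)]; norm_num
  calc |sqDiff c x y| ^ α ≤ (|x - y| ^ 2 + c) ^ α := by gcongr
    _ ≤ (|x - y| ^ 2) ^ α + c ^ α :=
        Real.rpow_add_le_add_rpow (by positivity) hc hα.le (by linarith)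
    _ = |x - y| ^ (2 * α) + c ^ α := by rw [h2]
    _ ≤ (|x| + |y|) ^ (2 * α) + c ^ α := by
        gcongr
        exact abs_sub _ _
    _ ≤ _ := by
        gcongr
        exact Real.rpow_add_le_add_rpow (abs_nonneg _) (abs_nonneg _) (by linarith) (by linarith)

/-- The properties of the centered squared distances `sqDiff c (X i k) (X j k)` of an i.i.d. array
that govern their largest sums: the laws `ν` of one of them and `ν'` of the sum of two with a common
row, their moments, and independence for disjoint pairs of rows. -/
structure SqDiffModel {Ω : Type*} [MeasurableSpace Ω] (X : ℕ → ℕ → Ω → ℝ) (P : Measure Ω)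
    (c v w α t : ℝ) (ν ν' : Measure ℝ) : Prop where
  pair : ∀ i j, i ≠ j → IIDSeq (fun k ω => sqDiff c (X i k ω) (X j k ω)) ν P
  triple : ∀ i j l, i ≠ j → i ≠ l → j ≠ l →
    IIDSeq (fun k ω => sqDiff c (X i k ω) (X j k ω) + sqDiff c (X i k ω) (X l k ω)) ν' P
  indep : ∀ i j i' j', i ≠ i' → i ≠ j' → j ≠ i' → j ≠ j' → ∀ n,
    IndepFun (fun ω => ∑ k ∈ Finset.range n, sqDiff c (X i k ω) (X j k ω))
      (fun ω => ∑ k ∈ Finset.range n, sqDiff c (X i' k ω) (X j' k ω)) P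
  pos : 0 < v
  mean : ∫ y, y ∂ν = 0
  var : ∫ y, y ^ 2 ∂ν = v
  exp : Integrable (fun y => Real.exp (t * |y| ^ α)) ν
  mean' : ∫ y, y ∂ν' = 0
  var' : ∫ y, y ^ 2 ∂ν' ≤ w
  exp' : Integrable (fun y => Real.exp (t * |y| ^ α)) ν'

theorem sqDiff_comm (c x y : ℝ) : sqDiff c x y = sqDiff c y x := by
  unfold sqDiff; ring

section Model

variable {Ω : Type*} [MeasurableSpace Ω] {P : Measure Ω} {X : ℕ → ℕ → Ω → ℝ}
  {α t₀ : ℝ}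

theorem integrable_exp_sqDiff {A B : Ω → ℝ} (hi : IndepFun A B P) (hmA : Measurable A)
    (hmB : Measurable B) (hα : 0 < α) (hα' : α ≤ 1 / 2) (ht₀ : 0 < t₀)
    (hA : Integrable (fun ω => Real.exp (t₀ * |A ω| ^ (2 * α))) P)
    (hB : Integrable (fun ω => Real.exp (t₀ * |B ω| ^ (2 * α))) P) {c : ℝ} (hc : 0 ≤ c) :
    Integrable (fun ω => Real.exp (t₀ * |sqDiff c (A ω) (B ω)| ^ α)) P := by
  have hi' := hi.comp (φ := fun x => Real.exp (t₀ * |x| ^ (2 * α)))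
    (ψ := fun x => Real.exp (t₀ * |x| ^ (2 * α))) (by fun_prop) (by fun_prop)
  have hint := (hi'.integrable_mul hA hB).mul_const (Real.exp (t₀ * c ^ α))
  have hm : Measurable fun ω => sqDiff c (A ω) (B ω) :=
    (measurable_sqDiff_uncurry c).comp (hmA.prodMk hmB)
  have he : Measurable fun y : ℝ => Real.exp (t₀ * |y| ^ α) := by fun_prop
  refine hint.mono' (he.comp hm).aestronglyMeasurable (Eventually.of_forall fun ω => ?_)
  rw [Real.norm_of_nonneg (Real.exp_pos _).le]
  simp only [Pi.mul_apply, Function.comp_apply]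
  rw [← Real.exp_add, ← Real.exp_add]
  apply Real.exp_le_exp.2
  have := abs_sqDiff_rpow_le hα hα' hc (A ω) (B ω)
  nlinarith

set_option maxHeartbeats 1000000 in
theorem exists_sqDiffModel [IsProbabilityMeasure P] (hmeas : ∀ i k, Measurable (X i k))
    (hindep : iIndepFun (fun ik : ℕ × ℕ => X ik.1 ik.2) P)
    (hident : ∀ i k, IdentDistrib (X i k) (X 0 0) P P) (hvar : 0 < Var[X 0 0; P])
    (hα : 0 < α) (hα' : α ≤ 1 / 2) (ht₀ : 0 < t₀)
    (hexp : Integrable (fun ω => Real.exp (t₀ * |X 0 0 ω| ^ (2 * α))) P)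
    (hcorr : corr P (fun ω => |X 0 0 ω - X 1 0 ω| ^ 2) (fun ω => |X 0 0 ω - X 2 0 ω| ^ 2) < 1 / 3) :
    ∃ (ν ν' : Measure ℝ) (w : ℝ), IsProbabilityMeasure ν ∧ IsProbabilityMeasure ν' ∧
      2 * (2 * (centralMoment (X 0 0) 4 P + centralMoment (X 0 0) 2 P ^ 2)) ≤ w ∧
      w < 8 / 3 * (2 * (centralMoment (X 0 0) 4 P + centralMoment (X 0 0) 2 P ^ 2)) ∧
      SqDiffModel X P (2 * centralMoment (X 0 0) 2 P)
        (2 * (centralMoment (X 0 0) 4 P + centralMoment (X 0 0) 2 P ^ 2)) w α (t₀ / 2) ν ν' := by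
  set c₂ := centralMoment (X 0 0) 2 P with hc₂
  set c₄ := centralMoment (X 0 0) 4 P with hc₄
  set v := 2 * (c₄ + c₂ ^ 2) with hv
  set μ := P.map (X 0 0) with hμ
  have : IsProbabilityMeasure μ := Measure.isProbabilityMeasure_map (hmeas 0 0).aemeasurable
  set m := ∫ ω, X 0 0 ω ∂P with hm
  have harr : IIDArray X μ P := ⟨hmeas, hindep, fun i k => (hident i k).map_eq⟩
  have hint : ∀ i k, ∀ f : ℝ → ℝ, Measurable f → ∫ ω, f (X i k ω) ∂P = ∫ ω, f (X 0 0 ω) ∂P :=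
    fun i k f hf => ((hident i k).comp hf).integral_eq
  have hexp' : ∀ i k, Integrable (fun ω => Real.exp (t₀ * |X i k ω| ^ (2 * α))) P := fun i k =>
    ((hident i k).comp (u := fun x => Real.exp (t₀ * |x| ^ (2 * α))) (by fun_prop)).integrable_iff.2
      hexp
  have hexpμ : Integrable (fun x => Real.exp (t₀ * |x| ^ (2 * α))) μ := by
    rw [hμ, integrable_map_measure (Measurable.aestronglyMeasurable (by fun_prop))
      (hmeas 0 0).aemeasurable]
    exact hexp
  have hpow : ∀ i k, ∀ j : ℕ, Integrable (fun ω => X i k ω ^ j) P := fun i k j => by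
    have h := integrable_pow_of_exp_rpow (by positivity) ht₀ hexpμ j
    rw [← harr.law i k] at h
    exact h.comp_measurable (hmeas i k)
  have hcpow : ∀ i k, ∀ j : ℕ, Integrable (fun ω => (X i k ω - m) ^ j) P := fun i k j => by
    simp only [sub_eq_add_neg, add_pow]
    exact integrable_finsetSum _ fun l _ => ((hpow i k l).mul_const _).mul_const _
  have hm1 : ∀ i k, ∫ ω, (X i k ω - m) ∂P = 0 := fun i k => by
    rw [hint i k (fun x => x - m) (by fun_prop), integral_sub (by simpa using hpow 0 0 1)
      (integrable_const _)]
    simp [hm]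
  have hm2 : ∀ i k, ∫ ω, (X i k ω - m) ^ 2 ∂P = c₂ := fun i k => by
    rw [hint i k (fun x => (x - m) ^ 2) (by fun_prop)]; rfl
  have hm4 : ∀ i k, ∫ ω, (X i k ω - m) ^ 4 ∂P = c₄ := fun i k => by
    rw [hint i k (fun x => (x - m) ^ 4) (by fun_prop)]; rfl
  have hc₂0 : 0 < c₂ := by
    rwa [variance_eq_integral (hmeas 0 0).aemeasurable, hm2 0 0] at hvar
  have hc₄0 : 0 ≤ c₄ := by
    rw [← hm4 0 0]; exact integral_nonneg fun ω => by positivity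
  have hv0 : 0 < v := by positivity
  have hij : ∀ i j, i ≠ j → IndepFun (X i 0) (X j 0) P := fun i j h =>
    hindep.indepFun (i := (i, 0)) (j := (j, 0)) (by simpa using h)
  have hD : ∀ i j, i ≠ j → HasMean P (fun ω => sqDiff (2 * c₂) (X i 0 ω) (X j 0 ω)) 0 ∧
      HasMean P (fun ω => sqDiff (2 * c₂) (X i 0 ω) (X j 0 ω) ^ 2) v := fun i j h =>
    HasMean.sqDiff_and_sq (hcpow i 0) (hcpow j 0) (hij i j h) (hm1 i 0) (hm1 j 0) (hm2 i 0)
      (hm2 j 0) (hm4 i 0) (hm4 j 0)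
  have hDm : ∀ i j, Measurable fun ω => sqDiff (2 * c₂) (X i 0 ω) (X j 0 ω) := fun i j =>
    (measurable_sqDiff_uncurry _).comp ((hmeas i 0).prodMk (hmeas j 0))
  set D₁ := fun ω => sqDiff (2 * c₂) (X 0 0 ω) (X 1 0 ω) with hD₁
  set D₂ := fun ω => sqDiff (2 * c₂) (X 0 0 ω) (X 2 0 ω) with hD₂
  have hprod : Integrable (fun ω => D₁ ω * D₂ ω) P := by
    refine (((hD 0 1 (by simp)).2.1.add (hD 0 2 (by simp)).2.1)).mono'
      ((hDm 0 1).mul (hDm 0 2)).aestronglyMeasurable (Eventually.of_forall fun ω => ?_)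
    simp only [Pi.add_apply]
    rw [Real.norm_eq_abs, abs_le]
    constructor <;> nlinarith [sq_nonneg (D₁ ω + D₂ ω), sq_nonneg (D₁ ω - D₂ ω), sq_nonneg (D₁ ω), sq_nonneg (D₂ ω)]
  have hmean : ∀ j, 0 ≠ j → ∫ ω, |X 0 0 ω - X j 0 ω| ^ 2 ∂P = 2 * c₂ := fun j hj => by
    have h := ((hD 0 j hj).1.add (HasMean.const (2 * c₂))).2
    rw [zero_add] at h
    rw [← h]
    congr 1
    ext ω
    simp only [sqDiff, sq_abs]; ring
  have hV : ∀ j, 0 ≠ j → Var[fun ω => |X 0 0 ω - X j 0 ω| ^ 2; P] = v := fun j hj => by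
    rw [variance_eq_integral (by
      have := hmeas 0 0; have := hmeas j 0; fun_prop), hmean j hj]
    simp only [sq_abs]
    exact (hD 0 j hj).2.2
  have hcov : ∫ ω, D₁ ω * D₂ ω ∂P < v / 3 := by
    rw [corr, hV 1 (by simp), hV 2 (by simp), Real.sqrt_mul_self hv0.le, div_lt_iff₀ hv0,
      covariance, hmean 1 (by simp), hmean 2 (by simp)] at hcorr
    simp only [sq_abs] at hcorr
    change ∫ ω, D₁ ω * D₂ ω ∂P < _ at hcorr
    linarith
  have hD12 : HasMean P (fun ω => (D₁ ω + D₂ ω) ^ 2) (2 * v + 2 * ∫ ω, D₁ ω * D₂ ω ∂P) := by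
    refine (((hD 0 1 (by simp)).2.add (hD 0 2 (by simp)).2).add
      (HasMean.const_mul ⟨hprod, rfl⟩ 2)).congr' (fun ω => ?_) (by ring)
    simp only [hD₁, hD₂]; ring
  have hg2 : Measurable fun z : Fin 2 → ℝ => sqDiff (2 * c₂) (z 0) (z 1) :=
    by unfold sqDiff; fun_prop
  have hg3 : Measurable fun z : Fin 3 → ℝ =>
      sqDiff (2 * c₂) (z 0) (z 1) + sqDiff (2 * c₂) (z 0) (z 2) :=
    by unfold sqDiff; fun_prop
  set ν := (Measure.pi fun _ : Fin 2 => μ).map fun z => sqDiff (2 * c₂) (z 0) (z 1) with hν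
  set ν' := (Measure.pi fun _ : Fin 3 => μ).map fun z =>
    sqDiff (2 * c₂) (z 0) (z 1) + sqDiff (2 * c₂) (z 0) (z 2) with hν'
  have hpair : ∀ i j, i ≠ j → IIDSeq (fun k ω => sqDiff (2 * c₂) (X i k ω) (X j k ω)) ν P := by
    intro i j h
    refine harr.comp_rows (r := ![i, j]) (fun a b hab => ?_) hg2
    fin_cases a <;> fin_cases b <;> simp_all
  have htriple : ∀ i j l, i ≠ j → i ≠ l → j ≠ l → IIDSeq (fun k ω =>
      sqDiff (2 * c₂) (X i k ω) (X j k ω) + sqDiff (2 * c₂) (X i k ω) (X l k ω)) ν' P := by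
    intro i j l h1 h2 h3
    refine harr.comp_rows (r := ![i, j, l]) (fun a b hab => ?_) hg3
    fin_cases a <;> fin_cases b <;> simp_all
  have hp01 := hpair 0 1 (by simp)
  have ht012 := htriple 0 1 2 (by simp) (by simp) (by simp)
  have hE : ∀ j, 0 ≠ j → Integrable
      (fun ω => Real.exp (t₀ * |sqDiff (2 * c₂) (X 0 0 ω) (X j 0 ω)| ^ α)) P := fun j hj =>
    integrable_exp_sqDiff (hij 0 j hj) (hmeas 0 0) (hmeas j 0) hα hα' ht₀ (hexp' 0 0) (hexp' j 0)
      (by positivity)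
  -- The second entry is the variance of `D₁ + D₂`, below `8v/3` by the correlation hypothesis. The
  -- maximum yields `2v ≤ w` without proving the covariance nonnegative.
  refine ⟨ν, ν', max (2 * v) (2 * v + 2 * ∫ ω, D₁ ω * D₂ ω ∂P),
    Measure.isProbabilityMeasure_map hg2.aemeasurable,
    Measure.isProbabilityMeasure_map hg3.aemeasurable, le_max_left _ _,
    max_lt (by linarith) (by linarith), ?_⟩
  refine ⟨hpair, htriple, ?_, hv0, ?_, ?_, ?_, ?_, ?_, ?_⟩
  · intro i j i' j' h1 h2 h3 h4 n
    exact harr.indepFun_rows h1 h2 h3 h4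
      (f := fun p => ∑ k ∈ Finset.range n, sqDiff (2 * c₂) (p.1 k) (p.2 k))
      (by unfold sqDiff; fun_prop)
  · rw [← hp01.integral_comp (f := fun y => y) measurable_id 0]
    exact (hD 0 1 (by simp)).1.2
  · rw [← hp01.integral_comp (f := fun y => y ^ 2) (by fun_prop) 0]
    exact (hD 0 1 (by simp)).2.2
  · rw [← hp01.law 0, integrable_map_measure (Measurable.aestronglyMeasurable (by fun_prop)) (hp01.measurable 0).aemeasurable]
    refine (hE 1 (by simp)).mono' ?_ (Eventually.of_forall fun ω => ?_)
    · exact Measurable.aestronglyMeasurable ((by fun_prop : Measurable fun y : ℝ =>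
        Real.exp (t₀ / 2 * |y| ^ α)).comp (hDm 0 1))
    · simp only [Function.comp_apply]
      rw [Real.norm_of_nonneg (Real.exp_pos _).le]
      apply Real.exp_le_exp.2
      gcongr
      linarith
  · rw [← ht012.integral_comp (f := fun y => y) measurable_id 0]
    simpa using ((hD 0 1 (by simp)).1.add (hD 0 2 (by simp)).1).2
  · rw [← ht012.integral_comp (f := fun y => y ^ 2) (by fun_prop) 0]
    exact hD12.2.le.trans (le_max_right _ _)
  · rw [← ht012.law 0, integrable_map_measure (Measurable.aestronglyMeasurable (by fun_prop)) (ht012.measurable 0).aemeasurable]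
    refine ((hE 1 (by simp)).add (hE 2 (by simp))).mono' ?_ (Eventually.of_forall fun ω => ?_)
    · exact Measurable.aestronglyMeasurable ((by fun_prop : Measurable fun y : ℝ =>
        Real.exp (t₀ / 2 * |y| ^ α)).comp ((hDm 0 1).add (hDm 0 2)))
    · simp only [Function.comp_apply, Pi.add_apply]
      rw [Real.norm_of_nonneg (Real.exp_pos _).le]
      change Real.exp (t₀ / 2 * |D₁ ω + D₂ ω| ^ α)
        ≤ Real.exp (t₀ * |D₁ ω| ^ α) + Real.exp (t₀ * |D₂ ω| ^ α)
      -- Halving the rate `t₀` lets the exponential of a sum, bounded by a product, be bounded by a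
      -- sum of exponentials at the full rate.
      have h1 : |D₁ ω + D₂ ω| ^ α ≤ |D₁ ω| ^ α + |D₂ ω| ^ α :=
        (Real.rpow_le_rpow (abs_nonneg _) (abs_add_le _ _) hα.le).trans
          (Real.rpow_add_le_add_rpow (abs_nonneg _) (abs_nonneg _) hα.le (by linarith))
      have h2 : ∀ y : ℝ, Real.exp (t₀ * y) = Real.exp (t₀ / 2 * y) ^ 2 := fun y => by
        rw [← Real.exp_nat_mul]; congr 1; push_cast; ring
      calc Real.exp (t₀ / 2 * |D₁ ω + D₂ ω| ^ α)
          ≤ Real.exp (t₀ / 2 * |D₁ ω| ^ α) * Real.exp (t₀ / 2 * |D₂ ω| ^ α) := by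
            rw [← Real.exp_add]
            apply Real.exp_le_exp.2
            rw [← mul_add]
            gcongr
        _ ≤ _ := by
            rw [h2, h2]
            nlinarith [sq_nonneg (Real.exp (t₀ / 2 * |D₁ ω| ^ α) - Real.exp (t₀ / 2 * |D₂ ω| ^ α)),
              sq_nonneg (Real.exp (t₀ / 2 * |D₁ ω| ^ α)), sq_nonneg (Real.exp (t₀ / 2 * |D₂ ω| ^ α))]

end Model

/-! ### Probability bounds at a single scale. -/

/-- The partial sums of the centered squared distances of two rows. -/
def sqDiffSum {Ω : Type*} (X : ℕ → ℕ → Ω → ℝ) (c : ℝ) (i j n : ℕ) (ω : Ω) : ℝ :=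
  ∑ k ∈ Finset.range n, sqDiff c (X i k ω) (X j k ω)

theorem sqDiffSum_comm {Ω : Type*} (X : ℕ → ℕ → Ω → ℝ) (c : ℝ) (i j n : ℕ) (ω : Ω) :
    sqDiffSum X c i j n ω = sqDiffSum X c j i n ω :=
  Finset.sum_congr rfl fun _ _ => sqDiff_comm _ _ _

/-- Since `a · a^(α/(2-α)) = a^(2/(2-α))`, this is the exponent for which levels of order `√(a H)`
meet the constraint `x^(2-α) ≤ η N` of the tail bound. -/
theorem exists_sqrt_rpow_le {α A δ : ℝ} (hα1 : α < 1) (hA : 0 < A) (hδ : 0 < δ) :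
    ∃ η > 0, ∀ a H : ℝ, 0 < a → 0 ≤ H → H ≤ η * a ^ (α / (2 - α)) →
      √(A * (a * H)) ^ (2 - α) ≤ δ * a := by
  have h2 : 0 < 2 - α := by linarith
  refine ⟨δ ^ (2 / (2 - α)) / A, by positivity, fun a H ha hH hHa => ?_⟩
  have h1 : A * (a * H) ≤ (δ * a) ^ (2 / (2 - α)) := by
    have e : a ^ (2 / (2 - α)) = a * a ^ (α / (2 - α)) := by
      rw [← Real.rpow_one_add' ha.le (by
        have : 1 + α / (2 - α) = 2 / (2 - α) := by field_simp; ring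
        rw [this]; positivity)]
      congr 1; field_simp; ring
    rw [Real.mul_rpow hδ.le ha.le, e]
    calc A * (a * H) ≤ A * (a * (δ ^ (2 / (2 - α)) / A * a ^ (α / (2 - α)))) := by gcongr
      _ = _ := by field_simp
  calc √(A * (a * H)) ^ (2 - α) = (A * (a * H)) ^ ((2 - α) / 2) := by
        rw [Real.sqrt_eq_rpow, ← Real.rpow_mul (by positivity)]; congr 1; ring
    _ ≤ ((δ * a) ^ (2 / (2 - α))) ^ ((2 - α) / 2) := by gcongr
    _ = δ * a := by
        rw [← Real.rpow_mul (by positivity)]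
        have : 2 / (2 - α) * ((2 - α) / 2) = 1 := by field_simp
        rw [this, Real.rpow_one]

theorem mul_sqrt_eq_sqrt_sq_mul {k : ℝ} (hk : 0 ≤ k) (a b : ℝ) :
    k * √(a * b) = √(k ^ 2 * a * b) := by
  rw [mul_assoc, Real.sqrt_mul (sq_nonneg k), Real.sqrt_sq hk]

theorem measureReal_exists_pair_le {Ω : Type*} [MeasurableSpace Ω] {P : Measure Ω}
    [IsProbabilityMeasure P] (E : ℕ → ℕ → Set Ω) (d : ℕ) {b : ℝ} (hb : 0 ≤ b)
    (hE : ∀ i j, i < j → P.real (E i j) ≤ b) :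
    P.real {ω | ∃ i j, i < j ∧ j < d ∧ ω ∈ E i j} ≤ d ^ 2 * b := by
  have hsub : {ω | ∃ i j, i < j ∧ j < d ∧ ω ∈ E i j} ⊆
      ⋃ q ∈ (Finset.range d ×ˢ Finset.range d).filter (fun q => q.1 < q.2), E q.1 q.2 := by
    rintro ω ⟨i, j, hij, hj, h⟩
    exact Set.mem_biUnion (x := (i, j)) (by simp [hij, hj, hij.trans hj]) h
  calc P.real {ω | ∃ i j, i < j ∧ j < d ∧ ω ∈ E i j}
      ≤ ∑ q ∈ (Finset.range d ×ˢ Finset.range d).filter (fun q => q.1 < q.2), P.real (E q.1 q.2) :=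
        (measureReal_mono hsub (measure_ne_top _ _)).trans (measureReal_biUnion_finset_le _ _)
    _ ≤ ∑ q ∈ (Finset.range d ×ˢ Finset.range d).filter (fun q => q.1 < q.2), b :=
        Finset.sum_le_sum fun q hq => hE _ _ (Finset.mem_filter.1 hq).2
    _ ≤ ∑ q ∈ Finset.range d ×ˢ Finset.range d, b :=
        Finset.sum_le_sum_of_subset_of_nonneg (Finset.filter_subset _ _) fun _ _ _ => hb
    _ = d ^ 2 * b := by simp [sq]

theorem two_mul_sq_mul_exp_log {h : ℕ} (hh : 1 ≤ h) (s : ℝ) :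
    ((2 * h : ℕ) : ℝ) ^ 2 * Real.exp (-(s * Real.log (2 * h)))
      = Real.exp (-((s - 2) * Real.log (2 * h))) := by
  have h0 : (0 : ℝ) < 2 * h := by
    have : (1 : ℝ) ≤ h := by exact_mod_cast hh
    linarith
  push_cast
  rw [← Real.exp_log (pow_pos h0 2), Real.log_pow, ← Real.exp_add]
  congr 1
  push_cast
  ring

namespace SqDiffModel

variable {Ω : Type*} [MeasurableSpace Ω] {X : ℕ → ℕ → Ω → ℝ} {P : Measure Ω}
  [IsProbabilityMeasure P] {c v w α t : ℝ} {ν ν' : Measure ℝ}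

/-- Large values of the sums over a short range of times are unlikely. -/
theorem exists_upper_bound [IsProbabilityMeasure ν] (M : SqDiffModel X P c v w α t ν ν') (hα : 0 < α) (hα1 : α < 1)
    (ht : 0 < t) {ε θ : ℝ} (hε : 0 < ε) (hθ : 1 < θ) (hθε : θ ≤ 1 + ε / 2) :
    ∃ η > 0, ∃ H₀ > 0, ∃ C > 0, ∀ a h : ℕ, 1 ≤ a → 1 ≤ h → H₀ ≤ Real.log (2 * h) →
      Real.log (2 * h) ≤ η * (a : ℝ) ^ (α / (2 - α)) →
      P.real {ω | ∃ i j, i < j ∧ j < 2 * (2 * h) ∧ ω ∈ {ω | ∃ n : ℕ, n ≤ θ * a ∧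
        (2 + ε) * √(v * (a * Real.log (2 * h))) ≤ sqDiffSum X c i j n ω}} ≤
        C * Real.exp (-(ε / 2 * Real.log (2 * h))) := by
  have hv := M.pos
  -- Then `1 - ε₁ = (1 + ε/4)/(1 + ε/2)`. With `(2 + ε)²/2 = 2 (1 + ε/2)²` and `a/N ≥ 1/(1 + ε/2)`
  -- the exponent is `2 + ε/2`; the number of pairs uses up `2`.
  set ε₁ := ε / 4 / (1 + ε / 2) with hε₁
  obtain ⟨η₁, hη₁, C, hC, htail⟩ := exists_max_sum_tail_le (ν := ν) P hα hα1 ht M.exp (ε := ε₁) hv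
    (by positivity) M.mean.le M.var.le
  obtain ⟨η, hη, hreg⟩ := exists_sqrt_rpow_le (α := α) (A := (2 + ε) ^ 2 * v) (δ := η₁) hα1
    (by positivity) hη₁
  refine ⟨η, hη, θ / (4 * v), by positivity, 4 * C, by positivity, fun a h ha hh hH₀ hHη => ?_⟩
  set H := Real.log (2 * h) with hH
  have hH0 : 0 < H := lt_of_lt_of_le (by positivity) hH₀
  have ha0 : (0 : ℝ) < a := by exact_mod_cast ha
  set N := ⌊θ * a⌋₊ with hN
  have hNθ : (N : ℝ) ≤ θ * a := Nat.floor_le (by positivity)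
  have haN : a ≤ N := Nat.le_floor (by nlinarith)
  have haN' : (a : ℝ) ≤ N := by exact_mod_cast haN
  have hN0 : (0 : ℝ) < N := by linarith
  set x := (2 + ε) * √(v * (a * H)) with hx
  have hx' : x = √((2 + ε) ^ 2 * v * (a * H)) :=
    mul_sqrt_eq_sqrt_sq_mul (by positivity) _ _
  have hxsq : x ^ 2 = (2 + ε) ^ 2 * v * (a * H) := by
    rw [hx', Real.sq_sqrt (by positivity)]
  have hpair : ∀ i j, i < j → P.real {ω | ∃ n : ℕ, n ≤ θ * a ∧ x ≤ sqDiffSum X c i j n ω} ≤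
      C * Real.exp (-((2 + ε / 2) * H)) := by
    intro i j hij
    have h1 := htail _ (M.pair i j hij.ne) N (ha.trans haN) x (by
      rw [hx']
      apply Real.sqrt_le_sqrt
      rw [div_le_iff₀ (by positivity)] at hH₀
      have : θ * a ≤ 4 * v * (a * H) := by nlinarith
      have h4 : (4 : ℝ) ≤ (2 + ε) ^ 2 := by nlinarith
      calc (N : ℝ) ≤ 4 * v * (a * H) := hNθ.trans this
        _ ≤ _ := by gcongr) (by
      rw [hx']
      refine (hreg a H ha0 hH0.le hHη).trans ?_
      gcongr)
    refine (measureReal_mono ?_).trans (h1.trans ?_)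
    · rintro ω ⟨n, hn, h⟩
      exact ⟨n, Nat.le_floor hn, h⟩
    · refine mul_le_mul_of_nonneg_left (Real.exp_le_exp.2 (neg_le_neg ?_)) hC.le
      rw [hxsq]
      have e1 : (2 + ε) ^ 2 * v * (a * H) / (2 * v * N) = (2 + ε) ^ 2 / 2 * (a / N) * H := by
        field_simp
      have e2 : 1 / (1 + ε / 2) ≤ a / N := by
        rw [div_le_div_iff₀ (by positivity) hN0]
        nlinarith
      have e3 : (1 - ε₁) = (1 + ε / 4) / (1 + ε / 2) := by rw [hε₁]; field_simp; ring
      rw [e1, e3]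
      calc (2 + ε / 2) * H
          = (1 + ε / 4) / (1 + ε / 2) * ((2 + ε) ^ 2 / 2 * (1 / (1 + ε / 2)) * H) := by
            field_simp; ring
        _ ≤ _ := by gcongr
  calc _ ≤ ((2 * (2 * h) : ℕ) : ℝ) ^ 2 * (C * Real.exp (-((2 + ε / 2) * H))) :=
        measureReal_exists_pair_le (fun i j => {ω | ∃ n : ℕ, n ≤ θ * a ∧
          x ≤ sqDiffSum X c i j n ω}) _ (by positivity) hpair
    _ = 4 * C * (((2 * h : ℕ) : ℝ) ^ 2 * Real.exp (-((2 + ε / 2) * H))) := by push_cast; ring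
    _ = _ := by rw [two_mul_sq_mul_exp_log hh]; congr 3; ring

/-- The sums are unlikely to drop much over a short range of times. -/
theorem exists_drop_bound [IsProbabilityMeasure ν] (M : SqDiffModel X P c v w α t ν ν') (hα : 0 < α) (hα1 : α < 1)
    (ht : 0 < t) {ε θ : ℝ} (hε : 0 < ε) (hθ : 1 < θ) (hθε : θ ≤ 1 + ε ^ 2 / 24) :
    ∃ η > 0, ∃ H₀ > 0, ∃ C > 0, ∃ a₀ : ℕ, ∀ a h : ℕ, a₀ ≤ a → 1 ≤ h → H₀ ≤ Real.log (2 * h) →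
      Real.log (2 * h) ≤ η * (a : ℝ) ^ (α / (2 - α)) →
      P.real {ω | ∃ i j, i < j ∧ j < 2 * h ∧ ω ∈ {ω | ∃ n : ℕ, a ≤ n ∧ n ≤ θ * a ∧
        sqDiffSum X c i j n ω ≤ sqDiffSum X c i j a ω - ε * √(v * (a * Real.log (2 * h)))}} ≤
        C * Real.exp (-Real.log (2 * h)) := by
  have hv := M.pos
  have hρ : 0 < θ - 1 := by linarith
  have : IsProbabilityMeasure (ν.map fun y => -y) :=
    Measure.isProbabilityMeasure_map measurable_neg.aemeasurable
  -- A drop after time `a` is a large maximal sum of the negated increments started at `a`.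
  obtain ⟨η₁, hη₁, C, hC, htail⟩ := exists_max_sum_tail_le (ν := ν.map fun y => -y) P hα hα1 ht
    (w := v) (ε := 1 / 2)
    (by
      rw [integrable_map_measure (Measurable.aestronglyMeasurable (by fun_prop))
        measurable_neg.aemeasurable]
      simpa [Function.comp_def] using M.exp) hv (by positivity)
    (by
      rw [integral_map (f := fun y => y) measurable_neg.aemeasurable
        measurable_id.aestronglyMeasurable, integral_neg, M.mean, neg_zero])
    (by
      rw [integral_map measurable_neg.aemeasurable (Measurable.aestronglyMeasurable (by fun_prop))]
      simpa using M.var.le)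
  obtain ⟨η, hη, hreg⟩ := exists_sqrt_rpow_le (α := α) (A := ε ^ 2 * v) (δ := η₁ * (θ - 1)) hα1
    (by positivity) (by positivity)
  refine ⟨η, hη, 2 * (θ - 1) / (ε ^ 2 * v), by positivity, C, hC, max 1 ⌈1 / (θ - 1)⌉₊,
    fun a h ha hh hH₀ hHη => ?_⟩
  set H := Real.log (2 * h) with hH
  have hH0 : 0 < H := lt_of_lt_of_le (by positivity) hH₀
  have ha1 : 1 ≤ a := (le_max_left _ _).trans ha
  have ha0 : (0 : ℝ) < a := by exact_mod_cast ha1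
  have haθ : 1 ≤ (θ - 1) * a := by
    have := Nat.ceil_le.1 ((le_max_right _ _).trans ha)
    rwa [div_le_iff₀ hρ, mul_comm] at this
  set N := ⌈(θ - 1) * a⌉₊ with hN
  have hN1 : (θ - 1) * a ≤ N := Nat.le_ceil _
  have hN2 : (N : ℝ) ≤ 2 * (θ - 1) * a := by
    have := (Nat.ceil_lt_add_one (a := (θ - 1) * a) (by positivity)).le
    rw [← hN] at this
    linarith
  have hN0 : (0 : ℝ) < N := by linarith
  set x := ε * √(v * (a * H)) with hx
  have hx' : x = √(ε ^ 2 * v * (a * H)) :=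
    mul_sqrt_eq_sqrt_sq_mul hε.le _ _
  have hxsq : x ^ 2 = ε ^ 2 * v * (a * H) := by
    rw [hx', Real.sq_sqrt (by positivity)]
  have hpair : ∀ i j, i < j → P.real {ω | ∃ n : ℕ, a ≤ n ∧ n ≤ θ * a ∧
      sqDiffSum X c i j n ω ≤ sqDiffSum X c i j a ω - x} ≤ C * Real.exp (-(3 * H)) := by
    intro i j hij
    have h1 := htail _ ((M.pair i j hij.ne).shift a).neg N (by exact_mod_cast hN0) x (by
      rw [hx']
      apply Real.sqrt_le_sqrt
      rw [div_le_iff₀ (by positivity)] at hH₀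
      refine hN2.trans ?_
      nlinarith) (by
      rw [hx']
      refine (hreg a H ha0 hH0.le hHη).trans ?_
      rw [mul_assoc]
      gcongr)
    refine (measureReal_mono ?_).trans (h1.trans ?_)
    · rintro ω ⟨n, han, hn, h⟩
      refine ⟨n - a, ?_, ?_⟩
      · have : ((n - a : ℕ) : ℝ) ≤ N := by
          rw [Nat.cast_sub han]; linarith
        exact_mod_cast this
      · have hs : sqDiffSum X c i j n ω = sqDiffSum X c i j a ω
            + ∑ k ∈ Finset.range (n - a), sqDiff c (X i (a + k) ω) (X j (a + k) ω) := by
          rw [sqDiffSum, sqDiffSum, ← Finset.sum_range_add_sum_Ico _ han,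
            Finset.sum_Ico_eq_sum_range]
        rw [Finset.sum_neg_distrib]
        linarith
    · refine mul_le_mul_of_nonneg_left (Real.exp_le_exp.2 (neg_le_neg ?_)) hC.le
      rw [hxsq]
      have e1 : ε ^ 2 * v * (a * H) / (2 * v * N) = ε ^ 2 / 2 * (a / N) * H := by
        field_simp
      -- The window has `N ≤ 2 (θ - 1) a ≤ (ε²/12) a` steps, so the Gaussian exponent is at least
      -- `6` and half of it is `3`, one more than the pairs cost.
      have e2 : 1 / (ε ^ 2 / 12) ≤ a / N := by
        rw [div_le_div_iff₀ (by positivity) hN0]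
        nlinarith
      rw [e1]
      calc 3 * H = (1 - 1 / 2) * (ε ^ 2 / 2 * (1 / (ε ^ 2 / 12)) * H) := by
            field_simp; norm_num
        _ ≤ _ := by gcongr
  calc _ ≤ ((2 * h : ℕ) : ℝ) ^ 2 * (C * Real.exp (-(3 * H))) :=
        measureReal_exists_pair_le (fun i j => {ω | ∃ n : ℕ, a ≤ n ∧ n ≤ θ * a ∧
          sqDiffSum X c i j n ω ≤ sqDiffSum X c i j a ω - x}) _ (by positivity) hpair
    _ = C * (((2 * h : ℕ) : ℝ) ^ 2 * Real.exp (-(3 * H))) := by ring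
    _ = _ := by rw [two_mul_sq_mul_exp_log hh]; congr 3; ring

set_option maxHeartbeats 1000000 in
/-- It is unlikely that all the sums are small. -/
theorem exists_lower_bound [IsProbabilityMeasure ν'] (M : SqDiffModel X P c v w α t ν ν') (hα : 0 < α) (hα1 : α < 1)
    (ht : 0 < t) (hw : 2 * v ≤ w) (hw' : w < 8 / 3 * v) {ε : ℝ} (hε : 0 < ε) (hε2 : ε < 2) :
    ∃ δ > 0, ∃ η > 0, ∃ H₀ > 0, ∃ C > 0, ∀ a h : ℕ, 1 ≤ a → 1 ≤ h → H₀ ≤ Real.log (2 * h) →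
      Real.log (2 * h) ≤ η * (a : ℝ) ^ (α / (2 - α)) →
      P.real {ω | ∀ i j, i < j → j < 2 * h →
        sqDiffSum X c i j a ω < (2 - ε) * √(v * (a * Real.log (2 * h)))} ≤
        C * Real.exp (-(δ * Real.log (2 * h))) := by
  have hv := M.pos
  have hw0 : 0 < w := by linarith
  have hε2' : 0 < 2 - ε := by linarith
  set s := (2 - ε) ^ 2 with hs
  have hs0 : 0 < s := by positivity
  have hs4 : s < 4 := by rw [hs]; nlinarith
  -- So `s = 4 - 64 ε₁`: this leaves room for the loss `ε₁` in each tail bound and for decay `8 ε₁`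
  -- in both second moment terms.
  set ε₁ := (1 - s / 4) / 16 with hε₁
  have hε₁0 : 0 < ε₁ := by rw [hε₁]; linarith
  have hε₁1 : ε₁ ≤ 1 := by rw [hε₁]; linarith
  obtain ⟨η₁, hη₁, C, hC, htail⟩ := exists_max_sum_tail_le (ν := ν') P hα hα1 ht M.exp' (ε := ε₁)
    hw0 hε₁0 M.mean'.le M.var'
  obtain ⟨A, hA, η₂, hη₂, hlow⟩ := exists_le_sum_tail P hv hε₁0 hε₁1 M.mean M.var
    (M.pair 0 1 (by simp))
  obtain ⟨η₃, hη₃, hreg⟩ := exists_sqrt_rpow_le (α := α) (A := 4 * (s * v)) (δ := η₁) hα1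
    (by positivity) hη₁
  refine ⟨8 * ε₁, by positivity, min η₃ (η₂ / (s * v)), by positivity, max 1 A / (s * v),
    by positivity, 4 + 4 * C, by positivity, fun a h ha hh hH₀ hHη => ?_⟩
  set H := Real.log (2 * h) with hH
  have hH0 : 0 < H := lt_of_lt_of_le (by positivity) hH₀
  have ha1 : (1 : ℝ) ≤ a := by exact_mod_cast ha
  have ha0 : (0 : ℝ) < a := by linarith
  have hh0 : (0 : ℝ) < h := by exact_mod_cast hh
  have hHη₃ : H ≤ η₃ * (a : ℝ) ^ (α / (2 - α)) := hHη.trans (by gcongr; exact min_le_left _ _)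
  have hHη₂ : H ≤ η₂ / (s * v) * a := by
    refine hHη.trans ?_
    gcongr
    · exact min_le_right _ _
    · refine (Real.rpow_le_rpow_of_exponent_le ha1 ?_).trans_eq (Real.rpow_one _)
      rw [div_le_one (by linarith)]; linarith
  rw [div_le_iff₀ (by positivity)] at hH₀
  have hH1 : 1 ≤ H * (s * v) := (le_max_left _ _).trans hH₀
  have hHA : A ≤ H * (s * v) := (le_max_right _ _).trans hH₀
  set x := (2 - ε) * √(v * (a * H)) with hx
  have hx0 : 0 ≤ x := by positivity
  have hxsq : x ^ 2 = s * v * (a * H) := by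
    rw [hx, mul_pow, Real.sq_sqrt (by positivity)]; ring
  have h2x : 2 * x = √(4 * (s * v) * (a * H)) := by
    rw [eq_comm, Real.sqrt_eq_iff_mul_self_eq (by positivity) (by positivity)]
    nlinarith
  have hmeas : ∀ i j, i ≠ j → Measurable fun ω => sqDiffSum X c i j a ω := fun i j hij =>
    (M.pair i j hij).measurable_sum _
  set q := P.real {ω | x ≤ sqDiffSum X c 0 1 a ω} with hq
  have hqeq : ∀ i j, i ≠ j → P.real {ω | x ≤ sqDiffSum X c i j a ω} = q := by
    intro i j hij
    have e := congrArg (fun μ => μ.real (Set.Ici x))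
      ((M.pair i j hij).map_sum_eq (M.pair 0 1 (by simp)) a)
    beta_reduce at e
    rwa [map_measureReal_apply ((M.pair i j hij).measurable_sum _) measurableSet_Ici,
      map_measureReal_apply ((M.pair 0 1 (by simp)).measurable_sum _) measurableSet_Ici] at e
  have hqlow : Real.exp (-((1 + ε₁) * (s / 2 * H))) ≤ q := by
    have h1 := hlow _ (M.pair 0 1 (by simp)) a ha x hx0 (by rw [hxsq]; nlinarith) (by
      rw [hxsq]
      calc s * v * (a * H) ≤ s * v * (a * (η₂ / (s * v) * a)) := by gcongr
        _ = η₂ * a ^ 2 := by field_simp)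
    refine le_trans (Real.exp_le_exp.2 (le_of_eq ?_)) h1
    rw [hxsq]; field_simp
  have hq0 : 0 < q := (Real.exp_pos _).trans_le hqlow
  set q₂ := C * Real.exp (-((1 - ε₁) * (2 * s * v / w * H))) with hq₂
  have hq₂le : ∀ i j l, i ≠ j → i ≠ l → j ≠ l →
      P.real ({ω | x ≤ sqDiffSum X c i j a ω} ∩ {ω | x ≤ sqDiffSum X c i l a ω}) ≤ q₂ := by
    intro i j l hij hil hjl
    -- If both sums reach `x`, their total reaches `2 x`.
    have h1 := htail _ (M.triple i j l hij hil hjl) a ha (2 * x) (by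
      rw [h2x]
      apply Real.sqrt_le_sqrt
      nlinarith) (by
      rw [h2x]
      exact hreg a H ha0 hH0.le hHη₃)
    refine (measureReal_mono ?_).trans (h1.trans (le_of_eq ?_))
    · rintro ω ⟨hω1, hω2⟩
      refine ⟨a, le_rfl, ?_⟩
      rw [Finset.sum_add_distrib]
      have hω1' : x ≤ sqDiffSum X c i j a ω := hω1
      have hω2' : x ≤ sqDiffSum X c i l a ω := hω2
      rw [sqDiffSum] at hω1' hω2'
      linarith
    · rw [hq₂]
      congr 4
      rw [mul_pow, hxsq]; field_simp
  -- Only pairs joining a row below `h` to one in `[h, 2h)` are used, so two pairs share a row only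
  -- when they share a coordinate of the grid. A common second coordinate reduces to `hq₂le` by
  -- symmetry.
  have hgrid := measureReal_forall_notMem_grid_le (P := P) (h := h) hh
    (E := fun b => {ω | x ≤ sqDiffSum X c b.1 (h + b.2) a ω}) (q := q) (q₂ := q₂)
    (fun b => measurableSet_le measurable_const (hmeas _ _ (by have := b.1.2; omega))) hq0
    (by positivity) (fun b => hqeq _ _ (by have := b.1.2; omega))
    (fun b b' h1 h2 => by
      have h1' : (b.1 : ℕ) ≠ b'.1 := fun h => h1 (Fin.ext h)
      have h2' : (b.2 : ℕ) ≠ b'.2 := fun h => h2 (Fin.ext h)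
      have hb := b.1.2
      have hb' := b'.1.2
      have hi := M.indep b.1 (h + b.2) b'.1 (h + b'.2) h1' (by omega) (by omega) (by omega) a
      have hprod := congrArg ENNReal.toReal (hi.measure_inter_preimage_eq_mul _ _
        (measurableSet_Ici (a := x)) (measurableSet_Ici (a := x)))
      rw [ENNReal.toReal_mul] at hprod
      refine hprod.trans ?_
      rw [sq]
      exact congrArg₂ (· * ·) (hqeq _ _ (by omega)) (hqeq _ _ (by omega)))
    (fun b b' hne hor => by
      have hb := b.1.2
      have hb' := b'.1.2
      rcases hor with h1 | h2
      · have h2' : (b.2 : ℕ) ≠ b'.2 := fun h => hne (Prod.ext h1 (Fin.ext h))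
        rw [← h1]
        exact hq₂le b.1 (h + b.2) (h + b'.2) (by omega) (by omega) (by omega)
      · have h1' : (b.1 : ℕ) ≠ b'.1 := fun h => hne (Prod.ext (Fin.ext h) h2)
        rw [← h2]
        simp only [sqDiffSum_comm X c _ (h + b.2)]
        exact hq₂le (h + b.2) b.1 b'.1 (by omega) (by omega) h1')
  have hexpH : Real.exp H = 2 * h := Real.exp_log (by positivity)
  have hterm1 : 1 / (h ^ 2 * q) ≤ 4 * Real.exp (-(8 * ε₁ * H)) := by
    rw [div_le_iff₀ (by positivity)]
    calc (1 : ℝ) ≤ Real.exp (-(8 * ε₁ * H) + (H + H) + -((1 + ε₁) * (s / 2 * H))) := by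
          apply Real.one_le_exp
          have h5 : 0 ≤ (-(8 * ε₁) + 2 - (1 + ε₁) * (s / 2)) := by
            rw [show s = 4 - 64 * ε₁ by rw [hε₁]; ring]; nlinarith
          have h6 := mul_nonneg h5 hH0.le
          linarith
      _ = 4 * Real.exp (-(8 * ε₁ * H)) * (h ^ 2 * Real.exp (-((1 + ε₁) * (s / 2 * H)))) := by
          rw [Real.exp_add, Real.exp_add, Real.exp_add, hexpH]; ring
      _ ≤ _ := by gcongr
  have hterm2 : 2 * q₂ / (h * q ^ 2) ≤ 4 * C * Real.exp (-(8 * ε₁ * H)) := by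
    rw [div_le_iff₀ (by positivity)]
    -- The correlation condition enters here: as `s → 4` the joint exponent `2 s v / w` stays at
    -- least `3`.
    have hvw : 3 / 4 ≤ 2 * v / w := by
      rw [div_le_div_iff₀ (by norm_num) hw0]; linarith
    calc 2 * q₂ = 2 * C * Real.exp (-((1 - ε₁) * (2 * s * v / w * H))) := by rw [hq₂]; ring
      _ ≤ 2 * C * Real.exp (-(8 * ε₁ * H) + H + (-((1 + ε₁) * (s / 2 * H))
            + -((1 + ε₁) * (s / 2 * H)))) := by
          refine mul_le_mul_of_nonneg_left (Real.exp_le_exp.2 ?_) (by positivity)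
          have e : 2 * s * v / w = s * (2 * v / w) := by ring
          have hk : (1 - ε₁) * (s * (3 / 4)) ≤ (1 - ε₁) * (s * (2 * v / w)) :=
            mul_le_mul_of_nonneg_left (mul_le_mul_of_nonneg_left hvw hs0.le) (by linarith)
          have h5 : 0 ≤ -(8 * ε₁) + 1 - (1 + ε₁) * s + (1 - ε₁) * (s * (3 / 4)) := by
            rw [show s = 4 - 64 * ε₁ by rw [hε₁]; ring]; nlinarith
          have h6 := mul_nonneg (h5.trans (add_le_add_right hk _)) hH0.le
          rw [e]
          linarith
      _ = 4 * C * Real.exp (-(8 * ε₁ * H)) * (h * Real.exp (-((1 + ε₁) * (s / 2 * H))) ^ 2) := by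
          rw [Real.exp_add, Real.exp_add, Real.exp_add, hexpH]; ring
      _ ≤ _ := by gcongr
  refine (measureReal_mono ?_).trans (hgrid.trans ?_)
  · intro ω hω b hb
    have h1 : sqDiffSum X c b.1 (h + b.2) a ω < x :=
      hω _ _ (by have := b.1.2; omega) (by have := b.2.2; omega)
    exact absurd hb (not_le.2 h1)
  · linarith

end SqDiffModel

/-! ### From single scales to almost sure convergence. -/

/-- Borel–Cantelli along the index `(m, l)` with `(m + 1) ^ 2 ≤ exp (δ * L l)` and summable
`exp (-δ * L l)`. -/
theorem ae_finite_setOf_mem_of_le_exp {Ω : Type*} [MeasurableSpace Ω] {P : Measure Ω}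
    [IsProbabilityMeasure P] {B : ℕ × ℕ → Set Ω} {C δ : ℝ} (hC : 0 ≤ C) {L : ℕ → ℝ}
    (hsum : Summable fun l => Real.exp (-(δ * L l)))
    (hB : ∀ m l : ℕ, ((m : ℝ) + 1) ^ 2 ≤ Real.exp (δ * L l) →
      P.real (B (m, l)) ≤ C * Real.exp (-(2 * δ * L l))) :
    ∀ᵐ ω ∂P, {ml : ℕ × ℕ | ((ml.1 : ℝ) + 1) ^ 2 ≤ Real.exp (δ * L ml.2) ∧ ω ∈ B ml}.Finite := by
  classical
  have h2 : Summable fun m : ℕ => 1 / ((m : ℝ) + 1) ^ 2 := by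
    have := (summable_nat_add_iff 1).2 (Real.summable_one_div_nat_pow.2 one_lt_two)
    simpa using this
  have hprod : Summable fun ml : ℕ × ℕ => C * (1 / ((ml.1 : ℝ) + 1) ^ 2 * Real.exp (-(δ * L ml.2))) :=
    (h2.mul_of_nonneg hsum (fun m => by positivity) fun l => (Real.exp_pos _).le).mul_left C
  set s : ℕ × ℕ → Set Ω := fun ml => {ω | ((ml.1 : ℝ) + 1) ^ 2 ≤ Real.exp (δ * L ml.2) ∧ ω ∈ B ml}
  have hs : ∀ ml, P (s ml)
      ≤ ENNReal.ofReal (C * (1 / ((ml.1 : ℝ) + 1) ^ 2 * Real.exp (-(δ * L ml.2)))) := by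
    rintro ⟨m, l⟩
    by_cases h : ((m : ℝ) + 1) ^ 2 ≤ Real.exp (δ * L l)
    · have h1 : P.real (s (m, l)) ≤ P.real (B (m, l)) := measureReal_mono fun ω hω => hω.2
      rw [← ofReal_measureReal]
      refine ENNReal.ofReal_le_ofReal (h1.trans ((hB m l h).trans ?_))
      refine mul_le_mul_of_nonneg_left ?_ hC
      -- One factor `exp (-δ L)` is traded for `(m + 1)⁻²`, the other is summable in `l`.
      rw [show -(2 * δ * L l) = -(δ * L l) + -(δ * L l) by ring, Real.exp_add, Real.exp_neg]
      refine mul_le_mul_of_nonneg_right ?_ (by positivity)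
      rw [one_div]
      exact inv_anti₀ (by positivity) h
    · have : s (m, l) = ∅ := by
        ext ω
        simp [s, h]
      rw [this]
      simp
  have hfin : ∑' ml, P (s ml) ≠ ⊤ :=
    ne_top_of_le_ne_top hprod.tsum_ofReal_ne_top (ENNReal.tsum_le_tsum hs)
  exact ae_finite_setOfPred_mem hfin

theorem norm_rowVec_sub_sq {Ω : Type*} (X : ℕ → ℕ → Ω → ℝ) (c : ℝ) (n i j : ℕ) (ω : Ω) :
    ‖rowVec X n i ω - rowVec X n j ω‖ ^ 2 = sqDiffSum X c i j n ω + n * c := by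
  rw [EuclideanSpace.norm_sq_eq, sqDiffSum]
  simp only [rowVec, sqDiff, Real.norm_eq_abs, sq_abs, Finset.sum_sub_distrib, Finset.sum_const,
    Finset.card_range, nsmul_eq_mul, sub_add_cancel]
  exact Fin.sum_univ_eq_sum_range (fun k => (X i k ω - X j k ω) ^ 2) n

theorem le_maxInterpointDist_sq {Ω : Type*} (X : ℕ → ℕ → Ω → ℝ) (c : ℝ) {p n i j : ℕ} (hij : i < j)
    (hj : j < p) (ω : Ω) : sqDiffSum X c i j n ω + n * c ≤ maxInterpointDist X p n ω ^ 2 := by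
  rw [← norm_rowVec_sub_sq]
  refine pow_le_pow_left₀ (norm_nonneg _) ?_ 2
  exact le_ciSup (f := fun q : {q : Fin p × Fin p // q.1 < q.2} =>
    ‖rowVec X n q.1.1 ω - rowVec X n q.1.2 ω‖) (Set.finite_range _).bddAbove
    ⟨(⟨i, hij.trans hj⟩, ⟨j, hj⟩), hij⟩

theorem maxInterpointDist_sq_le {Ω : Type*} (X : ℕ → ℕ → Ω → ℝ) (c : ℝ) {p n : ℕ} {b : ℝ} {ω : Ω}
    (hb : 0 ≤ b + n * c) (h : ∀ i j, i < j → j < p → sqDiffSum X c i j n ω ≤ b) :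
    maxInterpointDist X p n ω ^ 2 ≤ b + n * c := by
  have h1 : maxInterpointDist X p n ω ≤ √(b + n * c) := by
    -- The index set is empty for `p ≤ 1`, where the supremum is `0`; hence the nonnegativity side
    -- goal.
    refine Real.iSup_le (fun q => ?_) (Real.sqrt_nonneg _)
    apply Real.le_sqrt_of_sq_le
    rw [norm_rowVec_sub_sq X c]
    have := h q.1.1 q.1.2 q.2 q.1.2.2
    linarith
  have h0 : 0 ≤ maxInterpointDist X p n ω := Real.iSup_nonneg fun q => norm_nonneg _
  calc maxInterpointDist X p n ω ^ 2 ≤ √(b + n * c) ^ 2 := pow_le_pow_left₀ h0 h1 2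
    _ = b + n * c := Real.sq_sqrt hb

/-- The good event at time scale `a` for `2 * h` rows, controlling all times in `[a, θ * a]`. -/
structure IsRegularAt {Ω : Type*} (X : ℕ → ℕ → Ω → ℝ) (c v ε θ : ℝ) (a h : ℕ) (ω : Ω) :
    Prop where
  upper : ∀ i j, i < j → j < 2 * (2 * h) → ∀ n : ℕ, n ≤ θ * a →
    sqDiffSum X c i j n ω < (2 + ε) * √(v * (a * Real.log (2 * h)))
  drop : ∀ i j, i < j → j < 2 * h → ∀ n : ℕ, a ≤ n → n ≤ θ * a →
    sqDiffSum X c i j a ω - ε * √(v * (a * Real.log (2 * h))) < sqDiffSum X c i j n ω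
  lower : ∃ i j, i < j ∧ j < 2 * h ∧
    (2 - ε) * √(v * (a * Real.log (2 * h))) ≤ sqDiffSum X c i j a ω

theorem SqDiffModel.exists_not_isRegularAt_le {Ω : Type*} [MeasurableSpace Ω]
    {X : ℕ → ℕ → Ω → ℝ} {P : Measure Ω} [IsProbabilityMeasure P] {c v w α t : ℝ}
    {ν ν' : Measure ℝ} [IsProbabilityMeasure ν] [IsProbabilityMeasure ν']
    (M : SqDiffModel X P c v w α t ν ν') (hα : 0 < α) (hα1 : α < 1)
    (ht : 0 < t) (hw : 2 * v ≤ w) (hw' : w < 8 / 3 * v) {ε θ : ℝ} (hε : 0 < ε) (hε2 : ε < 2)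
    (hθ : 1 < θ) (hθ1 : θ ≤ 1 + ε / 2) (hθ2 : θ ≤ 1 + ε ^ 2 / 24) :
    ∃ δ > 0, ∃ η > 0, ∃ H₀ : ℝ, ∃ C > 0, ∃ a₀ : ℕ, ∀ a h : ℕ, a₀ ≤ a → 1 ≤ h →
      H₀ ≤ Real.log (2 * h) → Real.log (2 * h) ≤ η * (a : ℝ) ^ (α / (2 - α)) →
      P.real {ω | ¬ IsRegularAt X c v ε θ a h ω} ≤ C * Real.exp (-(δ * Real.log (2 * h))) := by
  obtain ⟨η₁, hη₁, H₁, hH₁, C₁, hC₁, h₁⟩ := M.exists_upper_bound hα hα1 ht hε hθ hθ1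
  obtain ⟨η₂, hη₂, H₂, hH₂, C₂, hC₂, a₂, h₂⟩ := M.exists_drop_bound hα hα1 ht hε hθ hθ2
  obtain ⟨δ₃, hδ₃, η₃, hη₃, H₃, hH₃, C₃, hC₃, h₃⟩ :=
    M.exists_lower_bound hα hα1 ht hw hw' hε hε2
  refine ⟨min (ε / 2) (min 1 δ₃), by positivity, min η₁ (min η₂ η₃), by positivity,
    max H₁ (max H₂ H₃), C₁ + C₂ + C₃, by positivity, max 1 a₂, fun a h ha hh hH hHη => ?_⟩
  have hH1 := (le_max_left _ _).trans hH
  have hH2 := (le_max_left _ _).trans ((le_max_right _ _).trans hH)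
  have hH3 := (le_max_right _ _).trans ((le_max_right _ _).trans hH)
  have ha1 := (le_max_left _ _).trans ha
  have ha2 := (le_max_right _ _).trans ha
  have hH0 := hH₁.trans_le hH1
  have hmono : ∀ η', min η₁ (min η₂ η₃) ≤ η' →
      Real.log (2 * h) ≤ η' * (a : ℝ) ^ (α / (2 - α)) := fun η' h' =>
    hHη.trans (mul_le_mul_of_nonneg_right h' (by positivity))
  have k₁ := h₁ a h ha1 hh hH1 (hmono _ (min_le_left _ _))
  have k₂ := h₂ a h ha2 hh hH2 (hmono _ ((min_le_right _ _).trans (min_le_left _ _)))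
  have k₃ := h₃ a h ha1 hh hH3 (hmono _ ((min_le_right _ _).trans (min_le_right _ _)))
  have hexp : ∀ s, min (ε / 2) (min 1 δ₃) ≤ s → Real.exp (-(s * Real.log (2 * h)))
      ≤ Real.exp (-(min (ε / 2) (min 1 δ₃) * Real.log (2 * h))) := fun s hs =>
    Real.exp_le_exp.2 (neg_le_neg (mul_le_mul_of_nonneg_right hs hH0.le))
  have e₁ := mul_le_mul_of_nonneg_left (hexp (ε / 2) (min_le_left _ _)) hC₁.le
  have e₂ := mul_le_mul_of_nonneg_left
    (hexp 1 ((min_le_right _ _).trans (min_le_left _ _))) hC₂.le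
  have e₃ := mul_le_mul_of_nonneg_left
    (hexp δ₃ ((min_le_right _ _).trans (min_le_right _ _))) hC₃.le
  rw [one_mul] at e₂
  set E₁ := {ω | ∃ i j, i < j ∧ j < 2 * (2 * h) ∧ ω ∈ {ω | ∃ n : ℕ, n ≤ θ * a ∧
    (2 + ε) * √(v * (a * Real.log (2 * h))) ≤ sqDiffSum X c i j n ω}} with hE₁
  set E₂ := {ω | ∃ i j, i < j ∧ j < 2 * h ∧ ω ∈ {ω | ∃ n : ℕ, a ≤ n ∧ n ≤ θ * a ∧
    sqDiffSum X c i j n ω ≤ sqDiffSum X c i j a ω - ε * √(v * (a * Real.log (2 * h)))}} with hE₂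
  set E₃ := {ω | ∀ i j, i < j → j < 2 * h →
    sqDiffSum X c i j a ω < (2 - ε) * √(v * (a * Real.log (2 * h)))} with hE₃
  have hsub : {ω | ¬ IsRegularAt X c v ε θ a h ω} ⊆ (E₁ ∪ E₂) ∪ E₃ := by
    intro ω hω
    by_contra hcon
    simp only [hE₁, hE₂, hE₃, Set.mem_union, Set.mem_ofPred_eq, not_or, not_exists, not_and,
      not_forall, not_le, not_lt] at hcon
    obtain ⟨⟨q1, q2⟩, i, j, hij, hj, q3⟩ := hcon
    exact hω ⟨q1, q2, i, j, hij, hj, q3⟩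
  have hfinal := (measureReal_mono (μ := P) hsub).trans ((measureReal_union_le _ _).trans
    (add_le_add (measureReal_union_le E₁ E₂) le_rfl))
  linarith

/-- `n / a` and `log p / log (2h)` are both in `[1, 1 + ε]`, so the normalisations at `(n, p)` and
`(a, 2h)` differ by a factor in that range. As `2h ≤ p < 4h`, the upper control covers `4h` rows
while the large pair is found among the first `2h`. That pair keeps at least `2 - 2ε` after a drop.
-/
theorem IsRegularAt.abs_sub_two_le {Ω : Type*} {X : ℕ → ℕ → Ω → ℝ} {c v ε θ : ℝ} {a h : ℕ} {ω : Ω}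
    (hreg : IsRegularAt X c v ε θ a h ω) (hc : 0 ≤ c) (hv : 0 < v) (hε : 0 < ε)
    (hθε : θ ≤ 1 + ε) {n p : ℕ} (ha : 1 ≤ a) (hh : 1 ≤ h) (han : a ≤ n) (hnθ : n ≤ θ * a)
    (hp : 2 * h ≤ p) (hp' : p < 2 * (2 * h)) (hlog : Real.log 2 ≤ ε * Real.log (2 * h)) :
    |(maxInterpointDist X p n ω ^ 2 - n * c) / √(v * (n * Real.log p)) - 2| ≤ 4 * ε := by
  set H := Real.log (2 * h) with hH
  have ha0 : (0 : ℝ) < a := by exact_mod_cast ha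
  have hh0 : (0 : ℝ) < h := by exact_mod_cast hh
  have hn0 : (0 : ℝ) < n := by exact_mod_cast ha.trans han
  have han' : (a : ℝ) ≤ n := by exact_mod_cast han
  have hp1 : (2 * h : ℝ) ≤ p := by exact_mod_cast hp
  have hp2 : (p : ℝ) ≤ 2 * (2 * h) := by exact_mod_cast hp'.le
  have hlog2 := Real.log_pos one_lt_two
  have hH0 : 0 < H := by nlinarith
  have hL1 : H ≤ Real.log p := Real.log_le_log (by positivity) hp1
  have hL2 : Real.log p ≤ (1 + ε) * H := by
    calc Real.log p ≤ Real.log (2 * (2 * h)) := Real.log_le_log (by linarith) hp2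
      _ = Real.log 2 + H := Real.log_mul (by norm_num) (by positivity)
      _ ≤ _ := by linarith
  set Q := √(v * (a * H)) with hQ
  set R := √(v * (n * Real.log p)) with hR
  have hQR : Q ≤ R := by
    apply Real.sqrt_le_sqrt
    gcongr
  have hQ0 : 0 < Q := Real.sqrt_pos.2 (by positivity)
  have hR0 : 0 < R := hQ0.trans_le hQR
  have hRQ : R ≤ (1 + ε) * Q := by
    rw [hQ, mul_sqrt_eq_sqrt_sq_mul (by positivity)]
    apply Real.sqrt_le_sqrt
    have h1 : (n : ℝ) ≤ (1 + ε) * a := hnθ.trans (by gcongr)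
    calc v * (n * Real.log p) ≤ v * (((1 + ε) * a) * ((1 + ε) * H)) := by gcongr
      _ = _ := by ring
  have hup : maxInterpointDist X p n ω ^ 2 ≤ (2 + ε) * Q + n * c :=
    maxInterpointDist_sq_le X c (by positivity) fun i j hij hj =>
      (hreg.upper i j hij (hj.trans hp') n hnθ).le
  obtain ⟨i, j, hij, hj, hlow⟩ := hreg.lower
  have hdrop := hreg.drop i j hij hj n han hnθ
  have hlo := le_maxInterpointDist_sq X c (n := n) hij (hj.trans_le hp) ω
  rw [abs_le]
  constructor
  · rw [neg_le_sub_iff_le_add, ← sub_le_iff_le_add, le_div_iff₀ hR0]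
    -- For a negative coefficient `R ≤ (1 + ε) Q` points the wrong way, and `Q ≤ R` serves instead.
    by_cases h2 : 0 ≤ 2 - 4 * ε
    · have : (2 - 4 * ε) * R ≤ (2 - 4 * ε) * ((1 + ε) * Q) := by gcongr
      nlinarith [mul_pos hε hQ0, mul_pos (mul_pos hε hε) hQ0]
    · nlinarith
  · rw [sub_le_iff_le_add, div_le_iff₀ hR0]
    nlinarith

/-- `m` is given by `θ^m ≤ n < θ^(m+1)` and `l` by the binary length of `p n`. The last condition
holds because `m` is `O(log n)` and `log log n = o(log (p n))`. -/
theorem eventually_exists_scale {p : ℕ → ℕ} {κ : ℝ} (hκ : 0 < κ)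
    (hp_upper : (fun n : ℕ => Real.log (p n)) =o[atTop] fun n : ℕ => (n : ℝ) ^ κ)
    (hp_lower : (fun n : ℕ => Real.log (Real.log n)) =o[atTop] fun n : ℕ => Real.log (p n))
    {θ δ η : ℝ} (hθ : 1 < θ) (hδ : 0 < δ) (hη : 0 < η) (a₀ m₀ : ℕ) (H₀ : ℝ) :
    ∀ᶠ n : ℕ in atTop, ∃ m l : ℕ, m₀ ≤ m ∧ ⌈θ ^ m⌉₊ ≤ n ∧ n ≤ θ * ⌈θ ^ m⌉₊ ∧
      2 * 2 ^ l ≤ p n ∧ p n < 2 * (2 * 2 ^ l) ∧ a₀ ≤ ⌈θ ^ m⌉₊ ∧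
      H₀ ≤ Real.log (2 * (2 ^ l : ℕ)) ∧
      Real.log (2 * (2 ^ l : ℕ)) ≤ η * (⌈θ ^ m⌉₊ : ℝ) ^ κ ∧
      ((m : ℝ) + 1) ^ 2 ≤ Real.exp (δ * Real.log (2 * (2 ^ l : ℕ))) := by
  have hlogθ := Real.log_pos hθ
  have hloglog : Tendsto (fun n : ℕ => Real.log (Real.log n)) atTop atTop :=
    Real.tendsto_log_atTop.comp (Real.tendsto_log_atTop.comp tendsto_natCast_atTop_atTop)
  have hlog : Tendsto (fun n : ℕ => Real.log n) atTop atTop :=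
    Real.tendsto_log_atTop.comp tendsto_natCast_atTop_atTop
  have hp0 : ∀ n, 0 ≤ Real.log (p n) := fun n => Real.log_natCast_nonneg _
  have hlow : ∀ c > 0, ∀ᶠ n : ℕ in atTop, Real.log (Real.log n) ≤ c * Real.log (p n) := fun c hc => by
    filter_upwards [hp_lower.bound hc] with n hn
    rw [Real.norm_of_nonneg (hp0 n)] at hn
    exact (le_abs_self _).trans hn
  have hlogp : Tendsto (fun n => Real.log (p n)) atTop atTop := by
    refine tendsto_atTop_mono' _ ?_ hloglog
    filter_upwards [hlow 1 one_pos] with n hn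
    linarith
  set K := 1 / Real.log θ + 1 with hK
  have hK0 : 0 < K := by positivity
  obtain ⟨m₁, hm₁⟩ := pow_unbounded_of_one_lt (a₀ : ℝ) hθ
  set m₂ := max m₀ m₁ with hm₂
  -- The factor `θ ^ κ` pays for replacing `n` by the smaller scale `⌈θ^m⌉₊`.
  filter_upwards [hp_upper.bound (c := η / θ ^ κ) (by positivity), hlow (δ / 4) (by positivity),
    hlogp.eventually_ge_atTop (H₀ + Real.log 2), hlogp.eventually_ge_atTop (Real.log 2),
    hlogp.eventually_ge_atTop (2 / δ * (2 * Real.log K + δ * Real.log 2)),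
    hlog.eventually_ge_atTop 1, eventually_ge_atTop 1,
    tendsto_natCast_atTop_atTop.eventually_ge_atTop (θ ^ m₂)] with n h1 h2 h3 h4 h5 h6 h7 h8
  have hn1 : (1 : ℝ) ≤ n := by exact_mod_cast h7
  obtain ⟨m, hm, hm'⟩ := exists_nat_pow_near hn1 hθ
  have hmm : m₂ ≤ m := by
    by_contra! hlt
    exact absurd (h8.trans_lt hm') (not_lt.2 (pow_le_pow_right₀ hθ.le hlt))
  have hpn2 : 2 ≤ p n := by
    by_contra! hlt
    have : Real.log (p n) ≤ 0 := by
      apply Real.log_nonpos (by positivity)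
      exact_mod_cast Nat.lt_succ_iff.1 hlt
    linarith [Real.log_pos one_lt_two]
  obtain ⟨l, hl⟩ : ∃ l, Nat.log 2 (p n) = l + 1 :=
    Nat.exists_eq_succ_of_ne_zero (Nat.log_pos one_lt_two hpn2).ne'
  have hl1 : 2 * 2 ^ l ≤ p n := by
    have := Nat.pow_log_le_self 2 (x := p n) (by omega)
    rwa [hl, pow_succ, mul_comm] at this
  have hl2 : p n < 2 * (2 * 2 ^ l) := by
    have := Nat.lt_pow_succ_log_self one_lt_two (p n)
    rw [hl, pow_succ, pow_succ] at this
    omega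
  have hθm : θ ^ m ≤ (⌈θ ^ m⌉₊ : ℝ) := Nat.le_ceil _
  have hθm0 : 0 < θ ^ m := by positivity
  have hnθ : (n : ℝ) ≤ θ * ⌈θ ^ m⌉₊ := by
    rw [pow_succ'] at hm'
    exact hm'.le.trans (by gcongr)
  set L := Real.log (2 * (2 ^ l : ℕ)) with hL
  have h2l : (0 : ℝ) < (2 ^ l : ℕ) := by positivity
  have hLp : L ≤ Real.log (p n) := by
    apply Real.log_le_log (by positivity)
    exact_mod_cast hl1
  have hpL : Real.log (p n) ≤ L + Real.log 2 := by
    rw [hL, add_comm, ← Real.log_mul (by norm_num) (by positivity)]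
    apply Real.log_le_log
    · exact_mod_cast (by omega : 0 < p n)
    · exact_mod_cast hl2.le
  refine ⟨m, l, (le_max_left _ _).trans hmm, Nat.ceil_le.2 hm, hnθ, hl1, hl2, ?_, by linarith,
    ?_, ?_⟩
  · have : (a₀ : ℝ) ≤ (⌈θ ^ m⌉₊ : ℝ) :=
      hm₁.le.trans ((pow_le_pow_right₀ hθ.le ((le_max_right _ _).trans hmm)).trans hθm)
    exact_mod_cast this
  · rw [Real.norm_of_nonneg (hp0 n), Real.norm_of_nonneg (by positivity)] at h1
    calc L ≤ η / θ ^ κ * (n : ℝ) ^ κ := hLp.trans h1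
      _ ≤ η / θ ^ κ * (θ * ⌈θ ^ m⌉₊) ^ κ := by gcongr
      _ = _ := by
        rw [Real.mul_rpow (by positivity) (by positivity)]
        field_simp
  · have hmlog : m * Real.log θ ≤ Real.log n := by
      rw [← Real.log_pow]
      exact Real.log_le_log hθm0 hm
    have hmK : (m : ℝ) + 1 ≤ K * Real.log n := by
      have : (m : ℝ) ≤ 1 / Real.log θ * Real.log n := by
        rw [one_div_mul_eq_div, le_div_iff₀ hlogθ]; exact hmlog
      rw [hK]
      linarith
    have hm1 : (0 : ℝ) < m + 1 := by positivity
    have hlogm : Real.log (m + 1) ≤ Real.log K + Real.log (Real.log n) := by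
      rw [← Real.log_mul hK0.ne' (by positivity)]
      exact Real.log_le_log hm1 hmK
    rw [← Real.exp_log (pow_pos hm1 2), Real.log_pow]
    apply Real.exp_le_exp.2
    rw [div_mul_eq_mul_div, div_le_iff₀ hδ] at h5
    have h9 := mul_le_mul_of_nonneg_left hpL hδ.le
    rw [Nat.cast_two]
    linarith

theorem summable_exp_neg_mul_log_two_mul_two_pow {δ : ℝ} (hδ : 0 < δ) :
    Summable fun l : ℕ => Real.exp (-(δ * Real.log (2 * (2 ^ l : ℕ)))) := by
  have h : ∀ l : ℕ, Real.exp (-(δ * Real.log (2 * (2 ^ l : ℕ))))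
      = Real.exp (-(δ * Real.log 2)) * Real.exp (-(δ * Real.log 2)) ^ l := fun l => by
    rw [← Real.exp_nat_mul, ← Real.exp_add]
    push_cast
    rw [Real.log_mul (by norm_num) (by positivity), Real.log_pow]
    congr 1
    ring
  simp only [h]
  refine (summable_geometric_of_lt_one (Real.exp_pos _).le ?_).mul_left _
  rw [Real.exp_lt_one_iff]
  have := mul_pos hδ (Real.log_pos one_lt_two)
  linarith

theorem SqDiffModel.ae_eventually_abs_sub_two_le {Ω : Type*} [MeasurableSpace Ω]
    {X : ℕ → ℕ → Ω → ℝ} {P : Measure Ω} [IsProbabilityMeasure P] {c v w α t : ℝ}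
    {ν ν' : Measure ℝ} [IsProbabilityMeasure ν] [IsProbabilityMeasure ν']
    (M : SqDiffModel X P c v w α t ν ν') (hc : 0 ≤ c) (hα : 0 < α) (hα1 : α < 1)
    (ht : 0 < t) (hw : 2 * v ≤ w) (hw' : w < 8 / 3 * v) {p : ℕ → ℕ}
    (hp_upper : (fun n : ℕ => Real.log (p n)) =o[atTop] fun n : ℕ => (n : ℝ) ^ (α / (2 - α)))
    (hp_lower : (fun n : ℕ => Real.log (Real.log n)) =o[atTop] fun n : ℕ => Real.log (p n))
    {ε : ℝ} (hε : 0 < ε) (hε1 : ε ≤ 1) :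
    ∀ᵐ ω ∂P, ∀ᶠ n : ℕ in atTop,
      |(maxInterpointDist X (p n) n ω ^ 2 - n * c) / √(v * (n * Real.log (p n))) - 2| ≤ 4 * ε := by
  have hκ : 0 < α / (2 - α) := div_pos hα (by linarith)
  set θ := 1 + ε ^ 2 / 24 with hθ
  have hθ1 : 1 < θ := by rw [hθ]; nlinarith
  have hθε : θ ≤ 1 + ε / 2 := by rw [hθ]; nlinarith
  obtain ⟨δ, hδ, η, hη, H₀, C, hC, a₀, hbound⟩ :=
    M.exists_not_isRegularAt_le hα hα1 ht hw hw' hε (by linarith) hθ1 hθε hθ.le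
  -- Admissibility is part of the event, so `B` is empty at scales where the probability bound is
  -- not available.
  set B : ℕ × ℕ → Set Ω := fun ml => {ω | (a₀ ≤ ⌈θ ^ ml.1⌉₊ ∧ H₀ ≤ Real.log (2 * (2 ^ ml.2 : ℕ)) ∧
    Real.log (2 * (2 ^ ml.2 : ℕ)) ≤ η * (⌈θ ^ ml.1⌉₊ : ℝ) ^ (α / (2 - α))) ∧
    ¬ IsRegularAt X c v ε θ ⌈θ ^ ml.1⌉₊ (2 ^ ml.2) ω} with hB
  have hfin := ae_finite_setOf_mem_of_le_exp (P := P) (B := B) (C := C) (δ := δ / 2) hC.le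
    (L := fun l => Real.log (2 * (2 ^ l : ℕ)))
    (summable_exp_neg_mul_log_two_mul_two_pow (half_pos hδ)) (fun m l _ => by
      by_cases hadm : a₀ ≤ ⌈θ ^ m⌉₊ ∧ H₀ ≤ Real.log (2 * (2 ^ l : ℕ)) ∧
        Real.log (2 * (2 ^ l : ℕ)) ≤ η * (⌈θ ^ m⌉₊ : ℝ) ^ (α / (2 - α))
      · refine (measureReal_mono fun ω hω => hω.2).trans
          ((hbound ⌈θ ^ m⌉₊ (2 ^ l) hadm.1 Nat.one_le_two_pow hadm.2.1 hadm.2.2).trans_eq ?_)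
        rw [mul_div_cancel₀ δ two_ne_zero]
      · have : B (m, l) = ∅ := by
          ext ω
          simp only [hB, Set.mem_ofPred_eq, hadm, false_and, Set.mem_empty_iff_false]
        rw [this, measureReal_empty]
        positivity)
  filter_upwards [hfin] with ω hω
  -- Finitely many bad scales have bounded `m`, and `m` exceeds the bound for large `n` whatever `l`
  -- is; no regularity of `p` is needed.
  obtain ⟨m₀, hm₀⟩ := (hω.image Prod.fst).bddAbove
  filter_upwards [eventually_exists_scale hκ hp_upper hp_lower hθ1 (half_pos hδ) hη a₀ (m₀ + 1)
    (max H₀ (Real.log 2 / ε))] with n hn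
  obtain ⟨m, l, hm, hmn, hnm, hl1, hl2, ha₀, hH₀, hHη, hml⟩ := hn
  have hreg : IsRegularAt X c v ε θ ⌈θ ^ m⌉₊ (2 ^ l) ω := by
    by_contra hnot
    have hmem : (m, l) ∈ {ml : ℕ × ℕ | ((ml.1 : ℝ) + 1) ^ 2
        ≤ Real.exp (δ / 2 * Real.log (2 * (2 ^ ml.2 : ℕ))) ∧ ω ∈ B ml} :=
      ⟨hml, ⟨ha₀, (le_max_left _ _).trans hH₀, hHη⟩, hnot⟩
    have := hm₀ (Set.mem_image_of_mem Prod.fst hmem)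
    simp only at this
    omega
  have hθm : 0 < θ ^ m := pow_pos (by linarith) m
  refine hreg.abs_sub_two_le hc M.pos hε (by linarith) (Nat.one_le_iff_ne_zero.2
    (Nat.ceil_pos.2 hθm).ne') Nat.one_le_two_pow hmn hnm hl1 hl2 ?_
  have := (le_max_right _ _).trans hH₀
  rwa [div_le_iff₀' hε] at this

theorem theorem2p4 {Ω : Type*} [MeasurableSpace Ω] (P : Measure Ω) [IsProbabilityMeasure P]
    (X : ℕ → ℕ → Ω → ℝ)
    (hmeas : ∀ i k, Measurable (X i k))
    (hindep : iIndepFun (fun ik : ℕ × ℕ => X ik.1 ik.2) P)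
    (hident : ∀ i k, IdentDistrib (X i k) (X 0 0) P P)
    (hvar : 0 < Var[X 0 0; P])
    (p : ℕ → ℕ) (α t₀ : ℝ) (hα : 0 < α) (hα' : α ≤ 1 / 2) (ht₀ : 0 < t₀)
    (hexp : Integrable (fun ω => Real.exp (t₀ * |X 0 0 ω| ^ (2 * α))) P)
    (hp_upper : (fun n : ℕ => Real.log (p n)) =o[atTop] fun n : ℕ => (n : ℝ) ^ (α / (2 - α)))
    (hp_lower : (fun n : ℕ => Real.log (Real.log n)) =o[atTop] fun n : ℕ => Real.log (p n))
    (hcorr : corr P (fun ω => |X 0 0 ω - X 1 0 ω| ^ 2) (fun ω => |X 0 0 ω - X 2 0 ω| ^ 2) < 1 / 3) :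
    ∀ᵐ ω ∂P, Tendsto
      (fun n : ℕ =>
        (maxInterpointDist X (p n) n ω ^ 2 - 2 * n * centralMoment (X 0 0) 2 P) /
          Real.sqrt (2 * (centralMoment (X 0 0) 4 P + centralMoment (X 0 0) 2 P ^ 2)
            * n * Real.log (p n)))
      atTop (𝓝 2) := by
  obtain ⟨ν, ν', w, hν, hν', hw, hw', M⟩ :=
    exists_sqDiffModel hmeas hindep hident hvar hα hα' ht₀ hexp hcorr
  have hc : 0 ≤ 2 * centralMoment (X 0 0) 2 P :=
    mul_nonneg two_pos.le (integral_nonneg fun ω => by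
      simp only [Pi.pow_apply]; positivity)
  have hall : ∀ᵐ ω ∂P, ∀ k : ℕ, ∀ᶠ n : ℕ in atTop, _ := ae_all_iff.2 fun k : ℕ =>
    M.ae_eventually_abs_sub_two_le hc hα (by linarith) (half_pos ht₀) hw hw' hp_upper hp_lower
      (ε := 1 / ((k : ℝ) + 1)) (by positivity) (by
        rw [div_le_one (by positivity)]; linarith [(Nat.cast_nonneg k : (0 : ℝ) ≤ k)])
  filter_upwards [hall] with ω hω
  rw [Metric.tendsto_atTop']
  intro ε hε
  obtain ⟨k, hk⟩ := exists_nat_one_div_lt (show 0 < ε / 4 by positivity)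
  obtain ⟨N, hN⟩ := eventually_atTop.1 (hω k)
  refine ⟨N, fun n hn => ?_⟩
  have h := hN n hn.le
  rw [Real.dist_eq]
  have e1 : 2 * (n : ℝ) * centralMoment (X 0 0) 2 P = n * (2 * centralMoment (X 0 0) 2 P) := by ring
  rw [e1, mul_assoc _ (n : ℝ)]
  exact h.trans_lt (by linarith)
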